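/- All spaces are real. For a nonempty set $B$ let $\ell_\infty(B)$ be the set of bounded functions $\varphi:B\to[0,\infty)$, with the coordinatewise order and the supremum norm. A function $f:\ell_\infty(B)\to[0,\infty)$ is monotone if $\varphi_1\le\varphi_2$ implies $f(\varphi_1)\le f(\varphi_2)$, and coercive if $f(\varphi)\to\infty$ as $\|\varphi\|_\infty\to\infty$. For a nonempty bounded subset $F$ of a normed space $E$, a function $f:\ell_\infty(F)\to[0,\infty)$ and $x\in E$ put $r_f(x,F)=f\big((\|x-a\|)_{a\in F}\big)$; for a linear subspace $V$ of $E$ let $$\mathrm{Cent}_V^f(F)=\Big\{v\in V:\ r_f(v,F)=\inf_{w\in V}r_f(w,F)\Big\}.$$ Theorem. Let $X$ be a Banach space, $Y$ a reflexive closed linear subspace of $X$, and $(\Omega,\Sigma,\mu)$ a finite measure space. For a sub-$\sigma$-algebra $\Sigma'\subseteq\Sigma$, regard the space $L_1(\Sigma',Y)$ of Bochner integrable $\Sigma'$-measurable $Y$-valued functions as a subspace of $L_1(\Sigma,X)$; likewise regard $L_\infty(\Sigma,Y)$ as a subspace of $L_\infty(\Sigma,X)$. (a) Let $F\subseteq L_1(\Sigma,X)$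 be nonempty and weakly compact, let $\Sigma'\subseteq\Sigma$ be a sub-$\sigma$-algebra, and let $f:\ell_\infty(F)\to[0,\infty)$ be monotone and coercive and such that $r_f(\cdot,F):L_1(\Sigma,X)\to[0,\infty)$ is weakly lower semicontinuous. Then $\mathrm{Cent}^f_{L_1(\Sigma',Y)}(F)\neq\emptyset$. (b) Let $F\subseteq L_\infty(\Sigma,X)$ be nonempty and bounded, regard $L_\infty(\Sigma,X)$ as a subspace of $L_1(\Sigma,X^*)^*$ through the canonical isometric embedding $J$, $(Jg)(\varphi)=\int_\Omega\varphi(\omega)(g(\omega))\,d\mu(\omega)$, and let $f:\ell_\infty(F)\to[0,\infty)$ be monotone and coercive and such that the function $x\mapsto f\big((\|x-Ja\|)_{a\in F}\big)$ from $L_1(\Sigma,X^*)^*$ to $[0,\infty)$ is weak$^*$-lower semicontinuous. Then $\mathrm{Cent}^f_{L_\infty(\Sigma,Y)}(F)\neq\emptyset$. -/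

import Mathlib

open MeasureTheory Filter Topology
open scoped ENNReal NNReal

noncomputable section

namespace FCenter

/-- A normed space is reflexive if the canonical embedding into its bidual is onto. -/
def IsReflexive (E : Type*) [NormedAddCommGroup E] [NormedSpace ℝ E] : Prop :=
  Function.Surjective (NormedSpace.inclusionInDoubleDual ℝ E)

/-- `F` is compact in the weak topology of `E`. -/
def IsWeaklyCompact {E : Type*} [NormedAddCommGroup E] [NormedSpace ℝ E] (F : Set E) : Prop :=
  IsCompact (toWeakSpace ℝ E '' F)

theorem IsWeaklyCompact.isBounded {E : Type*} [NormedAddCommGroup E] [NormedSpace ℝ E]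
    {F : Set E} (hF : IsWeaklyCompact F) : Bornology.IsBounded F := by
  have h1 := hF.image (NormedSpace.inclusionInDoubleDualWeak ℝ E).continuous
  have h2 := WeakDual.isBounded_iff_isVonNBounded.mpr (h1.isVonNBounded (𝕜 := ℝ))
  obtain ⟨C, hC⟩ := (isBounded_iff_forall_norm_le (E := StrongDual ℝ (StrongDual ℝ E))).1 h2
  refine isBounded_iff_forall_norm_le.2 ⟨C, fun x hx => ?_⟩
  have h3 := hC _ (Set.mem_image_of_mem _ (Set.mem_image_of_mem _ hx))
  exact ((NormedSpace.inclusionInDoubleDualLi (E := E) ℝ).norm_map x).symm.trans_le h3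

/-- `ℓ_∞(B)`: the bounded functions `B → [0, ∞)`, with the supremum norm of Mathlib's `lp`. -/
def EllInfNonneg (B : Type*) : Type _ :=
  {φ : lp (fun _ : B => ℝ) ∞ // ∀ b, 0 ≤ φ b}

/-- The coordinatewise order. -/
instance EllInfNonneg.instPreorder (B : Type*) : Preorder (EllInfNonneg B) :=
  Preorder.lift fun φ (b : B) => φ.1 b

theorem EllInfNonneg.le_iff {B : Type*} (φ ψ : EllInfNonneg B) :
    φ ≤ ψ ↔ ∀ b, φ.1 b ≤ ψ.1 b := Iff.rfl

/-- `f(φ) → ∞` as `‖φ‖_∞ → ∞`. -/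
def Coercive {B : Type*} (f : EllInfNonneg B → ℝ≥0) : Prop :=
  Tendsto f (comap (fun φ : EllInfNonneg B => ‖φ.1‖) atTop) atTop

section Centers

variable {E : Type*} [NormedAddCommGroup E]

theorem bddAbove_range_norm_sub {B : Type*} {a : B → E} (ha : Bornology.IsBounded (Set.range a))
    (x : E) : BddAbove (Set.range fun b => ‖x - a b‖) := by
  obtain ⟨C, hC⟩ := isBounded_iff_forall_norm_le.1 ha
  refine ⟨‖x‖ + C, ?_⟩
  rintro _ ⟨b, rfl⟩
  exact (norm_sub_le _ _).trans (by gcongr; exact hC _ ⟨b, rfl⟩)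

/-- The element `(‖x - a b‖)_{b ∈ B}` of `ℓ_∞(B)`, for a bounded family `a` in `E`. -/
def distTuple {B : Type*} (a : B → E) (ha : Bornology.IsBounded (Set.range a)) (x : E) :
    EllInfNonneg B :=
  ⟨⟨fun b => ‖x - a b‖, memℓp_infty (by simpa using bddAbove_range_norm_sub ha x)⟩,
    fun b => norm_nonneg (x - a b)⟩

/-- `r_f(x, a) = f((‖x - a b‖)_{b ∈ B})` for a bounded family `a` in `E`. -/
def rFam {B : Type*} (f : EllInfNonneg B → ℝ≥0) (a : B → E)
    (ha : Bornology.IsBounded (Set.range a)) (x : E) : ℝ≥0 :=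
  f (distTuple a ha x)

/-- `r_f(x, F) = f((‖x - a‖)_{a ∈ F})` for a bounded set `F`. -/
def r {F : Set E} (hF : Bornology.IsBounded F) (f : EllInfNonneg F → ℝ≥0) (x : E) : ℝ≥0 :=
  rFam f (fun a : F => (a : E)) (by rwa [Subtype.range_coe]) x

/-- `rad_Y^f(F) = inf_{y ∈ Y} r_f(y, F)`. -/
def rad [NormedSpace ℝ E] {F : Set E} (hF : Bornology.IsBounded F) (f : EllInfNonneg F → ℝ≥0)
    (Y : Submodule ℝ E) : ℝ≥0 :=
  ⨅ y : Y, r hF f (y : E)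

/-- The set `Cent_Y^f(F)` of restricted `f`-centers of `F` in `Y`. -/
def cent [NormedSpace ℝ E] {F : Set E} (hF : Bornology.IsBounded F) (f : EllInfNonneg F → ℝ≥0)
    (Y : Submodule ℝ E) : Set E :=
  {y | y ∈ Y ∧ r hF f y = rad hF f Y}

end Centers

section Bochner

variable {X : Type*} [NormedAddCommGroup X] [NormedSpace ℝ X]
  {Ω : Type*} {mΩ : MeasurableSpace Ω}

/-- `L_p(Σ', Y)` as a subspace of `L_p(Σ, X)`: the classes that contain a strongly
`Σ'`-measurable function with values in the subspace `Y`. -/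
def lpSub (p : ℝ≥0∞) (μ : Measure Ω) (m' : MeasurableSpace Ω) (Y : Submodule ℝ X) :
    Submodule ℝ (Lp X p μ) where
  carrier := {g | ∃ u : Ω → Y, StronglyMeasurable[m'] u ∧ g =ᵐ[μ] fun ω => (u ω : X)}
  zero_mem' := ⟨0, stronglyMeasurable_zero, by
    filter_upwards [Lp.coeFn_zero X p μ] with ω h using by simpa using h⟩
  add_mem' := by
    rintro g h ⟨u, hu, hgu⟩ ⟨v, hv, hhv⟩
    refine ⟨u + v, hu.add hv, ?_⟩
    filter_upwards [Lp.coeFn_add g h, hgu, hhv] with ω h1 h2 h3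
    rw [h1, Pi.add_apply, h2, h3, Pi.add_apply, Submodule.coe_add]
  smul_mem' := by
    rintro c g ⟨u, hu, hgu⟩
    refine ⟨c • u, hu.const_smul c, ?_⟩
    filter_upwards [Lp.coeFn_smul c g, hgu] with ω h1 h2
    rw [h1, Pi.smul_apply, h2, Pi.smul_apply, Submodule.coe_smul]

/-- For a bounded bilinear form `B` on `X × X'`, the bounded operator
`L_∞(Σ, X) → L_1(Σ, X')*`, `g ↦ (φ ↦ ∫ B(g(ω), φ(ω)) dμ(ω))`. -/
def pairing {X' : Type*} [NormedAddCommGroup X'] [NormedSpace ℝ X'] (B : X →L[ℝ] X' →L[ℝ] ℝ)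
    (μ : Measure Ω) : Lp X ∞ μ →L[ℝ] StrongDual ℝ (Lp X' 1 μ) :=
  B.lpPairing μ ∞ 1

theorem pairing_apply {X' : Type*} [NormedAddCommGroup X'] [NormedSpace ℝ X']
    (B : X →L[ℝ] X' →L[ℝ] ℝ) (μ : Measure Ω) (g : Lp X ∞ μ) (φ : Lp X' 1 μ) :
    pairing B μ g φ = ∫ ω, B (g ω) (φ ω) ∂μ :=
  ContinuousLinearMap.lpPairing_eq_integral B g φ

theorem isBounded_range_pairing {X' : Type*} [NormedAddCommGroup X'] [NormedSpace ℝ X']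
    (B : X →L[ℝ] X' →L[ℝ] ℝ) (μ : Measure Ω) {F : Set (Lp X ∞ μ)} (hF : Bornology.IsBounded F) :
    Bornology.IsBounded (Set.range fun a : F => pairing B μ (a : Lp X ∞ μ)) := by
  have h := (pairing B μ).lipschitz.isBounded_image hF
  rwa [Set.image_eq_range] at h

/-- `x ↦ f((‖x - pairing B a‖)_{a ∈ F})` on `L_1(Σ, X')*`, for a bounded set `F` in
`L_∞(Σ, X)`. -/
def rPairing {X' : Type*} [NormedAddCommGroup X'] [NormedSpace ℝ X'] (B : X →L[ℝ] X' →L[ℝ] ℝ)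
    (μ : Measure Ω) {F : Set (Lp X ∞ μ)} (hF : Bornology.IsBounded F)
    (f : EllInfNonneg F → ℝ≥0) (x : StrongDual ℝ (Lp X' 1 μ)) : ℝ≥0 :=
  rFam f (fun a : F => pairing B μ (a : Lp X ∞ μ)) (isBounded_range_pairing B μ hF) x

/-- `r_f(·, F)` on `L_1(Σ, X*)*`, for a bounded set `F` in `L_∞(Σ, X)` that is regarded as a
subset of `L_1(Σ, X*)*` through the canonical embedding `g ↦ (φ ↦ ∫ φ(ω)(g(ω)) dμ(ω))`. -/
def rDual (μ : Measure Ω) {F : Set (Lp X ∞ μ)} (hF : Bornology.IsBounded F)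
    (f : EllInfNonneg F → ℝ≥0) (x : StrongDual ℝ (Lp (StrongDual ℝ X) 1 μ)) : ℝ≥0 :=
  rPairing (NormedSpace.inclusionInDoubleDual ℝ X) μ hF f x

end Bochner

end FCenter

end

/-! Both parts use the direct method: coercivity bounds a minimizing sequence, a limit of it is
taken in a weak topology, and lower semicontinuity makes the limit a center. Countably many strongly
measurable functions live in one separable closed subspace `Z` of `Y`, which is again reflexive, so
`Z*` and `Z**` are separable and measures dominated by `μ` with values in such duals have densities
(`exists_dual_density`). Hence uniformly bounded sequences of `Z`-valued functions have limits along
an ultrafilter, tested against integrable `Z*`-valued functions (`exists_ultralimit_of_bounded`).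
Since `L_∞(Σ, X)` embeds isometrically into `L_1(Σ, X*)*`, this settles the case of `L_∞`.

In `L_1` a bounded sequence need not be uniformly integrable, so weak limits can fail to exist. The
remedy is to cut off the part of the mass that escapes to infinity
(`exists_uniformly_integrable_seq`). A weakly compact `F` is uniformly integrable, so on the small
sets where the escaping mass lives the elements of `F` are negligible. Removing that mass brings the
functions no farther from any point of `F`, and by monotonicity of `f` the truncated sequence is
still minimizing. It is uniformly integrable, so it has a weak limit
(`exists_forall_dual_tendsto_of_uniformly_integrable`), which stays in the norm closed subspace
`L_1(Σ', Y)` by Hahn-Banach. -/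

noncomputable section

namespace FCenter

/-! ### Reflexivity, separability and weak limits in normed spaces. -/

section FunctionalAnalysis

variable {E : Type*} [NormedAddCommGroup E] [NormedSpace ℝ E]

theorem mem_of_isClosed_of_forall_dual {Z : Submodule ℝ E} (hZ : IsClosed (Z : Set E)) {x : E}
    (h : ∀ f : StrongDual ℝ E, (∀ z ∈ Z, f z = 0) → f x = 0) : x ∈ Z := by
  by_contra hx
  obtain ⟨f, u, hfx, hfZ⟩ := geometric_hahn_banach_point_closed (E := E) Z.convex hZ hx
  have hf0 : ∀ z ∈ Z, f z = 0 := by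
    intro z hz
    by_contra hne
    -- A functional bounded below by `u` on a subspace vanishes there: otherwise this multiple of
    -- `z` takes the value `u - 1`.
    have h1 := hfZ (((u - 1) / f z) • z) (Z.smul_mem _ hz)
    rw [map_smul, smul_eq_mul, div_mul_cancel₀ _ hne] at h1
    linarith
  have h0 := hfZ 0 Z.zero_mem
  rw [map_zero] at h0
  have := h f hf0
  linarith

/-- A functional on `Z*` acts on `E*` through restriction to `Z`, so some `x` in `E` represents it.
Functionals vanishing on `Z` restrict to zero and hence vanish at `x`, which puts `x` in `Z`;
functionals on `Z` are reached by Hahn-Banach extension. -/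
theorem IsReflexive.of_isClosed (hE : IsReflexive E) {Z : Submodule ℝ E}
    (hZ : IsClosed (Z : Set E)) : IsReflexive Z := by
  intro ψ
  obtain ⟨x, hx⟩ := hE (ψ.comp (ContinuousLinearMap.precomp ℝ Z.subtypeL))
  have hx' : ∀ f : StrongDual ℝ E, f x = ψ (f.comp Z.subtypeL) := fun f =>
    congrArg (fun φ : StrongDual ℝ (StrongDual ℝ E) => φ f) hx
  have hxZ : x ∈ Z := by
    refine mem_of_isClosed_of_forall_dual hZ fun f hf => ?_
    rw [hx', show f.comp Z.subtypeL = 0 by ext z; exact hf z z.2, map_zero]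
  refine ⟨⟨x, hxZ⟩, ?_⟩
  ext g
  obtain ⟨f, hf, -⟩ := _root_.exists_extension_norm_eq Z g
  have hfg : f.comp Z.subtypeL = g := by ext z; exact hf z
  rw [NormedSpace.dual_def, ← hfg, ← hx']
  rfl

theorem exists_norm_le_one_norm_le_two_mul (f : StrongDual ℝ E) :
    ∃ x : E, ‖x‖ ≤ 1 ∧ ‖f‖ ≤ 2 * ‖f x‖ := by
  rcases eq_or_ne f 0 with rfl | hf
  · exact ⟨0, by simp⟩
  · have : ‖f‖ / 2 < ‖f‖ := half_lt_self (norm_pos_iff.2 hf)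
    obtain ⟨x, hx, hfx⟩ := f.exists_lt_apply_of_lt_opNorm this
    exact ⟨x, hx.le, by linarith⟩

/-- Almost norming vectors for a dense sequence of functionals span a dense subspace. If `f` kills
them all and `g` from the sequence is close to `f`, then `‖g‖ ≤ 2‖f - g‖`, so `‖f‖ ≤ 3‖f - g‖`; this
explains the choice of `‖f‖ / 3`. -/
theorem separableSpace_of_separableSpace_dual
    [TopologicalSpace.SeparableSpace (StrongDual ℝ E)] : TopologicalSpace.SeparableSpace E := by
  choose x hx hfx using
    fun n => exists_norm_le_one_norm_le_two_mul (TopologicalSpace.denseSeq (StrongDual ℝ E) n)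
  have hsep : TopologicalSpace.IsSeparable
      ((Submodule.span ℝ (Set.range x)).topologicalClosure : Set E) :=
    (Set.countable_range x).isSeparable.span.closure
  rw [← TopologicalSpace.isSeparable_univ_iff]
  refine hsep.mono fun y _ => ?_
  refine mem_of_isClosed_of_forall_dual (Submodule.isClosed_topologicalClosure _) fun f hf => ?_
  suffices f = 0 by rw [this]; rfl
  by_contra hne
  have hpos := norm_pos_iff.2 hne
  obtain ⟨n, hn⟩ := (TopologicalSpace.denseRange_denseSeq (StrongDual ℝ E)).exists_dist_lt f
    (show 0 < ‖f‖ / 3 by positivity)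
  set g := TopologicalSpace.denseSeq (StrongDual ℝ E) n
  have h0 : f (x n) = 0 :=
    hf _ (Submodule.le_topologicalClosure _ (Submodule.subset_span ⟨n, rfl⟩))
  have h1 : ‖g (x n)‖ ≤ ‖f - g‖ := by
    have h2 := (f - g).le_opNorm_of_le (hx n)
    rwa [sub_apply, h0, zero_sub, norm_neg, mul_one] at h2
  rw [dist_eq_norm] at hn
  have h3 := hfx n
  have h4 : ‖f‖ ≤ ‖f - g‖ + ‖g‖ := by simpa using norm_add_le (f - g) g
  linarith

theorem IsReflexive.separableSpace_dual (hE : IsReflexive E)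
    [TopologicalSpace.SeparableSpace E] : TopologicalSpace.SeparableSpace (StrongDual ℝ E) := by
  have : TopologicalSpace.SeparableSpace (StrongDual ℝ (StrongDual ℝ E)) :=
    hE.denseRange.separableSpace (NormedSpace.inclusionInDoubleDual ℝ E).continuous
  exact separableSpace_of_separableSpace_dual

/-- The norm is weakly lower semicontinuous, so the weak limits of the approximating families form a
Cauchy sequence as the error tends to zero. Its limit is the weak limit sought. -/
theorem exists_forall_dual_tendsto_of_approx [CompleteSpace E] {ι : Type*} {l : Filter ι} [l.NeBot]
    (x : ι → E)
    (h : ∀ ε > 0, ∃ (y : ι → E) (z : E),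
      (∀ Λ : StrongDual ℝ E, Tendsto (fun n => Λ (y n)) l (𝓝 (Λ z))) ∧
        ∀ᶠ n in l, ‖x n - y n‖ ≤ ε) :
    ∃ z, ∀ Λ : StrongDual ℝ E, Tendsto (fun n => Λ (x n)) l (𝓝 (Λ z)) := by
  have hε : ∀ k : ℕ, (0 : ℝ) < 1 / (k + 1) := fun k => Nat.one_div_pos_of_nat
  choose y z hyz hxy using fun k : ℕ => h _ (hε k)
  have hdist : ∀ k l : ℕ, ‖z k - z l‖ ≤ 1 / (k + 1) + 1 / (l + 1) := by
    intro k j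
    refine NormedSpace.norm_le_dual_bound ℝ _ (by positivity) fun Λ => ?_
    have h1 : Tendsto (fun n => ‖Λ (y k n - y j n)‖) l (𝓝 ‖Λ (z k - z j)‖) := by
      simp only [map_sub]
      exact ((hyz k Λ).sub (hyz j Λ)).norm
    refine le_of_tendsto h1 ?_
    filter_upwards [hxy k, hxy j] with n h2 h3
    have h4 : ‖y k n - y j n‖ ≤ 1 / (k + 1) + 1 / (j + 1) := by
      rw [norm_sub_rev] at h2
      have := norm_add_le (y k n - x n) (x n - y j n)
      rw [sub_add_sub_cancel] at this
      linarith
    rw [mul_comm]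
    exact Λ.le_opNorm_of_le h4
  have hlim := tendsto_one_div_add_atTop_nhds_zero_nat (𝕜 := ℝ)
  have hcauchy : CauchySeq z := by
    refine cauchySeq_of_le_tendsto_0 (fun N : ℕ => 1 / ((N : ℝ) + 1) + 1 / (N + 1)) ?_
      (by simpa using hlim.add hlim)
    intro n m N hn hm
    rw [dist_eq_norm]
    refine (hdist n m).trans ?_
    gcongr
  obtain ⟨w, hw⟩ := cauchySeq_tendsto_of_complete hcauchy
  refine ⟨w, fun Λ => ?_⟩
  rw [Metric.tendsto_nhds]
  intro ε hεp
  have h1 : Tendsto (fun k : ℕ => ‖Λ‖ * (1 / ((k : ℝ) + 1)) + ‖Λ‖ * ‖z k - w‖) atTop (𝓝 0) := by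
    have := (hlim.const_mul ‖Λ‖).add ((tendsto_iff_norm_sub_tendsto_zero.1 hw).const_mul ‖Λ‖)
    simpa using this
  obtain ⟨k, hk⟩ := (h1.eventually_lt_const (half_pos hεp)).exists
  filter_upwards [hxy k, (Metric.tendsto_nhds.1 (hyz k Λ)) _ (half_pos hεp)] with n h2 h3
  have h4 := Λ.le_opNorm_of_le h2
  have h5 := Λ.le_opNorm (z k - w)
  rw [dist_eq_norm] at h3 ⊢
  have h6 : Λ (x n) - Λ w = Λ (x n - y k n) + (Λ (y k n) - Λ (z k)) + Λ (z k - w) := by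
    simp only [map_sub]; ring
  rw [h6]
  refine (norm_add₃_le).trans_lt ?_
  linarith

theorem tendsto_toWeakSpace {ι : Type*} {l : Filter ι} {x : ι → E} {z : E}
    (h : ∀ Λ : StrongDual ℝ E, Tendsto (fun n => Λ (x n)) l (𝓝 (Λ z))) :
    Tendsto (fun n => toWeakSpace ℝ E (x n)) l (𝓝 (toWeakSpace ℝ E z)) :=
  (WeakBilin.tendsto_iff_forall_eval_tendsto _ fun _ _ hxy =>
    (SeparatingDual.eq_iff_forall_dual_eq (R := ℝ)).2 fun f => congrArg (fun φ => φ f) hxy).2 h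

theorem dual_tendsto_of_tendsto_toWeakSpace {ι : Type*} {l : Filter ι} {x : ι → E} {z : E}
    (h : Tendsto (fun n => toWeakSpace ℝ E (x n)) l (𝓝 (toWeakSpace ℝ E z)))
    (Λ : StrongDual ℝ E) : Tendsto (fun n => Λ (x n)) l (𝓝 (Λ z)) :=
  ((WeakBilin.eval_continuous (topDualPairing ℝ E).flip Λ).tendsto _).comp h

theorem mem_of_isClosed_of_dual_tendsto {ι : Type*} {l : Filter ι} [l.NeBot]
    {Z : Submodule ℝ E} (hZ : IsClosed (Z : Set E)) {x : ι → E} {z : E} (hx : ∀ n, x n ∈ Z)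
    (h : ∀ Λ : StrongDual ℝ E, Tendsto (fun n => Λ (x n)) l (𝓝 (Λ z))) : z ∈ Z := by
  refine mem_of_isClosed_of_forall_dual hZ fun f hf => ?_
  have h1 := h f
  simp only [hf _ (hx _)] at h1
  exact (tendsto_nhds_unique h1 tendsto_const_nhds)

end FunctionalAnalysis

/-! ### Radon-Nikodym densities with values in a separable dual. -/

section Density

variable {Ω : Type*} {mΩ : MeasurableSpace Ω}

/-- Closed balls suffice because every open set is a countable union of them. In a dual, closed
balls are convenient: they are cut out by conditions on evaluations. -/
theorem measurable_of_closedBall {γ : Type*} [PseudoMetricSpace γ]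
    [TopologicalSpace.SeparableSpace γ] [MeasurableSpace γ] [BorelSpace γ] {f : Ω → γ}
    (hf : ∀ x r, MeasurableSet (f ⁻¹' Metric.closedBall x r)) : Measurable f := by
  refine measurable_of_isOpen fun U hU => ?_
  rcases isEmpty_or_nonempty γ with hγ | hγ
  · rw [Set.eq_empty_of_isEmpty U]; exact MeasurableSet.empty
  have hU' : U = ⋃ n : ℕ, ⋃ k : ℕ, ⋃ _ : Metric.closedBall (TopologicalSpace.denseSeq γ n)
      (1 / ((k : ℝ) + 1)) ⊆ U,
      Metric.closedBall (TopologicalSpace.denseSeq γ n) (1 / ((k : ℝ) + 1)) := by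
    refine Set.Subset.antisymm (fun x hx => ?_) (by simp)
    obtain ⟨ε, hε, hxU⟩ := Metric.isOpen_iff.1 hU x hx
    obtain ⟨k, hk⟩ := exists_nat_one_div_lt (half_pos hε)
    obtain ⟨n, hn⟩ := (TopologicalSpace.denseRange_denseSeq γ).exists_dist_lt x
      (show (0 : ℝ) < 1 / ((k : ℝ) + 1) from Nat.one_div_pos_of_nat)
    simp only [Set.mem_iUnion]
    refine ⟨n, k, fun y hy => hxU ?_, Metric.mem_closedBall.2 hn.le⟩
    rw [Metric.mem_closedBall] at hy
    rw [Metric.mem_ball]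
    rw [dist_comm] at hn
    linarith [dist_triangle y (TopologicalSpace.denseSeq γ n) x]
  rw [hU', Set.preimage_iUnion]
  simp only [Set.preimage_iUnion]
  exact MeasurableSet.iUnion fun n => MeasurableSet.iUnion fun k => MeasurableSet.iUnion fun _ =>
    hf _ _

/-- Pettis measurability, for maps into a separable dual. -/
theorem stronglyMeasurable_dual_of_dense {D : Type*} [NormedAddCommGroup D] [NormedSpace ℝ D]
    [TopologicalSpace.SeparableSpace (StrongDual ℝ D)] {S : Set D} (hSc : S.Countable)
    (hS : Dense S) {g : Ω → StrongDual ℝ D} (hg : ∀ s ∈ S, Measurable fun ω => g ω s) :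
    StronglyMeasurable g := by
  borelize (StrongDual ℝ D)
  have : SecondCountableTopology (StrongDual ℝ D) :=
    UniformSpace.secondCountable_of_separable _
  refine Measurable.stronglyMeasurable (measurable_of_closedBall fun h r => ?_)
  rcases lt_or_ge r 0 with hr | hr
  · rw [Metric.closedBall_eq_empty.2 hr]; simp
  -- The operator norm can be tested on the countable dense set `S`, so the preimage is a countable
  -- intersection.
  have : g ⁻¹' Metric.closedBall h r = ⋂ s ∈ S, {ω | |g ω s - h s| ≤ r * ‖s‖} := by
    ext ω
    simp only [Set.mem_preimage, Metric.mem_closedBall, dist_eq_norm, Set.mem_iInter,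
      Set.mem_ofPred_eq]
    constructor
    · intro hω s _
      exact (g ω - h).le_of_opNorm_le hω s
    · intro hω
      refine ContinuousLinearMap.opNorm_le_bound _ hr fun x => ?_
      exact hS.induction (P := fun x => ‖(g ω - h) x‖ ≤ r * ‖x‖) hω
        (isClosed_le (by fun_prop) (by fun_prop)) x
  rw [this]
  exact MeasurableSet.biInter hSc fun s hs =>
    measurableSet_le (((hg s hs).sub measurable_const).abs) measurable_const

variable {μ : Measure Ω} [IsFiniteMeasure μ]

theorem ae_abs_le_of_forall_abs_setIntegral_le {h : Ω → ℝ} (hh : Integrable h μ) {K : ℝ}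
    (hK : ∀ s, MeasurableSet s → |∫ ω in s, h ω ∂μ| ≤ K * μ.real s) : ∀ᵐ ω ∂μ, |h ω| ≤ K := by
  have hc : ∀ s, ∫ _ in s, K ∂μ = K * μ.real s := fun s => by
    rw [setIntegral_const, smul_eq_mul, mul_comm]
  have h1 := ae_le_of_forall_setIntegral_le hh (integrable_const K) fun s hs _ => by
    rw [hc]; exact (le_abs_self _).trans (hK s hs)
  have h2 := ae_le_of_forall_setIntegral_le hh.neg (integrable_const K) fun s hs _ => by
    rw [hc]; simp only [Pi.neg_apply, integral_neg]; exact (neg_le_abs _).trans (hK s hs)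
  filter_upwards [h1, h2] with ω h3 h4
  exact abs_le'.2 ⟨h3, h4⟩

/-- Domination by a multiple of `μ` upgrades finite additivity to countable additivity and gives
absolute continuity, so the scalar Radon-Nikodym theorem applies. Setting `m` to zero on
nonmeasurable sets fits the convention for vector measures. -/
theorem exists_real_density {K : ℝ} (hK : 0 ≤ K) (m : Set Ω → ℝ)
    (hadd : ∀ s t, MeasurableSet s → MeasurableSet t → Disjoint s t → m (s ∪ t) = m s + m t)
    (hb : ∀ s, MeasurableSet s → |m s| ≤ K * μ.real s) :
    ∃ h : Ω → ℝ, Measurable h ∧ Integrable h μ ∧ (∀ᵐ ω ∂μ, |h ω| ≤ K) ∧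
      ∀ s, MeasurableSet s → ∫ ω in s, h ω ∂μ = m s := by
  classical
  let ν : SignedMeasure Ω := VectorMeasure.of_additive_of_le_measure (μ := K.toNNReal • μ)
    (fun s => if MeasurableSet s then m s else 0)
    (fun s => by
      split_ifs with hs
      · rw [Real.enorm_eq_ofReal_abs]
        refine (ENNReal.ofReal_le_ofReal (hb s hs)).trans_eq ?_
        rw [ENNReal.ofReal_mul hK, ofReal_measureReal]
        rfl
      · simp)
    (fun s t hs ht hst => by simp only [hs, ht, hs.union ht, if_true]; exact hadd s t hs ht hst)
    (fun s hs => if_neg hs)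
  have hν : ∀ s, MeasurableSet s → ν s = m s := fun s hs => if_pos hs
  have hac : ν ≪ᵥ μ.toENNRealVectorMeasure := by
    refine VectorMeasure.AbsolutelyContinuous.mk fun s hs h0 => ?_
    rw [Measure.toENNRealVectorMeasure_apply_measurable hs] at h0
    rw [hν s hs]
    have := hb s hs
    rw [measureReal_def, h0] at this
    simpa using this
  have hint : Integrable (ν.rnDeriv μ) μ := SignedMeasure.integrable_rnDeriv ν μ
  have hset : ∀ s, MeasurableSet s → ∫ ω in s, ν.rnDeriv μ ω ∂μ = m s := fun s hs => by
    rw [← withDensityᵥ_apply hint hs, SignedMeasure.withDensityᵥ_rnDeriv_eq ν μ hac, hν s hs]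
  exact ⟨ν.rnDeriv μ, SignedMeasure.measurable_rnDeriv ν μ, hint,
    ae_abs_le_of_forall_abs_setIntegral_le hint fun s hs => by rw [hset s hs]; exact hb s hs, hset⟩

/-- A bounded additive function on a dense additive subgroup extends to a functional. -/
theorem exists_dual_extension {D : Type*} [NormedAddCommGroup D] [NormedSpace ℝ D]
    {S : Submodule ℤ D} (hS : Dense (S : Set D)) {C : ℝ} (hC : 0 ≤ C) (φ : D → ℝ)
    (hadd : ∀ s ∈ S, ∀ t ∈ S, φ (s + t) = φ s + φ t) (hb : ∀ s ∈ S, |φ s| ≤ C * ‖s‖) :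
    ∃ g : StrongDual ℝ D, ‖g‖ ≤ C ∧ ∀ s ∈ S, g s = φ s := by
  let ψ : S →+ ℝ := AddMonoidHom.mk' (fun s => φ s) fun s t => hadd s s.2 t t.2
  have hψ : Continuous ψ := (AddMonoidHomClass.lipschitz_of_bound ψ C fun s : S => hb s s.2).continuous
  let ψ' : S →L[ℤ] ℝ := ⟨ψ.toIntLinearMap, hψ⟩
  let e : S →L[ℤ] D := ⟨S.subtype, continuous_subtype_val⟩
  have he : IsUniformInducing e := isUniformEmbedding_subtype_val.isUniformInducing
  have hd : DenseRange e := by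
    have : Set.range e = S := Subtype.range_coe
    rw [DenseRange, this]; exact hS
  let G : D →L[ℤ] ℝ := ψ'.extend e
  have hG : ∀ s ∈ S, G s = φ s := fun s hs => ContinuousLinearMap.extend_eq ψ' hd he ⟨s, hs⟩
  -- A continuous additive map between real topological vector spaces is automatically real linear.
  let g : StrongDual ℝ D := (G : D →+ ℝ).toRealLinearMap G.continuous
  have hg : ∀ x, g x = G x := fun x => rfl
  refine ⟨g, ContinuousLinearMap.opNorm_le_bound _ hC fun x => ?_, fun s hs => hG s hs⟩
  refine hS.induction (P := fun x => ‖g x‖ ≤ C * ‖x‖) (fun s hs => ?_)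
    (isClosed_le (by fun_prop) (by fun_prop)) x
  rw [hg, hG s hs]
  exact hb s hs

/-- Radon-Nikodym theorem for measures with values in a separable dual. -/
theorem exists_dual_density {D : Type*} [NormedAddCommGroup D] [NormedSpace ℝ D]
    [TopologicalSpace.SeparableSpace D] [TopologicalSpace.SeparableSpace (StrongDual ℝ D)]
    {C : ℝ} (hC : 0 ≤ C) (m : D → Set Ω → ℝ)
    (hadd : ∀ d e s, MeasurableSet s → m (d + e) s = m d s + m e s)
    (hdisj : ∀ d s t, MeasurableSet s → MeasurableSet t → Disjoint s t →
      m d (s ∪ t) = m d s + m d t)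
    (hb : ∀ d s, MeasurableSet s → |m d s| ≤ C * ‖d‖ * μ.real s) :
    ∃ g : Ω → StrongDual ℝ D, StronglyMeasurable g ∧ (∀ ω, ‖g ω‖ ≤ C) ∧
      ∀ d s, MeasurableSet s → ∫ ω in s, g ω d ∂μ = m d s := by
  choose h hmeas hint hbd hset using fun d => exists_real_density (μ := μ)
    (mul_nonneg hC (norm_nonneg d)) (m d) (hdisj d) (hb d)
  -- The integer span is dense yet countable, so additivity of all the scalar densities on it holds
  -- outside a single null set.
  let S : Submodule ℤ D := Submodule.span ℤ (Set.range (TopologicalSpace.denseSeq D))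
  have hSd : Dense (S : Set D) :=
    (TopologicalSpace.denseRange_denseSeq D).mono Submodule.subset_span
  have hSc : Countable S := inferInstance
  have hae_add : ∀ d e, ∀ᵐ ω ∂μ, h (d + e) ω = h d ω + h e ω := by
    intro d e
    refine Integrable.ae_eq_of_forall_setIntegral_eq _ _ (hint _) ((hint d).add (hint e)) ?_
    intro s hs _
    rw [hset _ _ hs, integral_add (hint d).integrableOn (hint e).integrableOn, hset _ _ hs,
      hset _ _ hs, hadd _ _ _ hs]
  let good : Set Ω := {ω | (∀ d e : S, h ((d : D) + e) ω = h d ω + h e ω) ∧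
    ∀ d : S, |h d ω| ≤ C * ‖(d : D)‖}
  have hgood_meas : MeasurableSet good := by
    simp only [good, Set.ofPred_and, Set.ofPred_forall]
    refine MeasurableSet.inter (MeasurableSet.iInter fun d => MeasurableSet.iInter fun e => ?_)
      (MeasurableSet.iInter fun d => ?_)
    · exact measurableSet_eq_fun (hmeas _) ((hmeas _).add (hmeas _))
    · exact measurableSet_le (hmeas _).abs measurable_const
  have hgood : ∀ᵐ ω ∂μ, ω ∈ good := by
    have h1 : ∀ᵐ ω ∂μ, ∀ d e : S, h ((d : D) + e) ω = h d ω + h e ω :=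
      ae_all_iff.2 fun d => ae_all_iff.2 fun e => hae_add d e
    have h2 : ∀ᵐ ω ∂μ, ∀ d : S, |h d ω| ≤ C * ‖(d : D)‖ := ae_all_iff.2 fun d => hbd d
    filter_upwards [h1, h2] with ω h3 h4 using ⟨h3, h4⟩
  -- Off `good` the zero functional is taken, so that the bound by `C` holds everywhere and
  -- evaluations at points of `S` stay measurable.
  have hex : ∀ ω, ∃ g : StrongDual ℝ D, ‖g‖ ≤ C ∧ ∀ s ∈ S, g s = good.indicator (h s) ω := by
    intro ω
    by_cases hω : ω ∈ good
    · refine exists_dual_extension hSd hC _ (fun s hs t ht => ?_) (fun s hs => ?_)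
      · simp only [Set.indicator_of_mem hω]
        exact hω.1 ⟨s, hs⟩ ⟨t, ht⟩
      · simp only [Set.indicator_of_mem hω]
        exact hω.2 ⟨s, hs⟩
    · exact ⟨0, by simpa using hC, fun s _ => by simp [Set.indicator_of_notMem hω]⟩
  choose g hgn hgS using hex
  have hgm : StronglyMeasurable g := by
    refine stronglyMeasurable_dual_of_dense (S := (S : Set D)) (Set.to_countable _) hSd ?_
    intro s hs
    simp only [hgS _ s hs]
    exact (hmeas s).indicator hgood_meas
  refine ⟨g, hgm, hgn, fun d s hs => ?_⟩
  have hgint : ∀ d, IntegrableOn (fun ω => g ω d) s μ := fun d =>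
    (Integrable.of_bound (hgm.aestronglyMeasurable.apply_continuousLinearMap d) (C * ‖d‖)
      (ae_of_all _ fun ω => (g ω).le_of_opNorm_le (hgn ω) d)).integrableOn
  have hgS' : ∀ d ∈ S, ∫ ω in s, g ω d ∂μ = m d s := by
    intro d hd
    rw [← hset d s hs]
    refine integral_congr_ae (ae_restrict_of_ae ?_)
    filter_upwards [hgood] with ω hω
    rw [hgS ω d hd, Set.indicator_of_mem hω]
  -- Both sides are continuous and additive in `d`, so agreement on the dense set `S` is enough.
  let I : D →+ ℝ := AddMonoidHom.mk' (fun d => ∫ ω in s, g ω d ∂μ) fun d e => by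
    simp only [map_add]
    exact integral_add (hgint d) (hgint e)
  let M : D →+ ℝ := AddMonoidHom.mk' (fun d => m d s) fun d e => hadd d e s hs
  have hI : Continuous I := (AddMonoidHomClass.lipschitz_of_bound I (C * μ.real s) fun d => by
    refine (norm_setIntegral_le_of_norm_le_const (measure_lt_top μ s) fun ω _ =>
      (g ω).le_of_opNorm_le (hgn ω) d).trans_eq ?_
    ring).continuous
  have hM : Continuous M := (AddMonoidHomClass.lipschitz_of_bound M (C * μ.real s) fun d => by
    refine (hb d s hs).trans_eq ?_
    ring).continuous
  exact congrFun (hI.ext_on hSd hM hgS') d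

end Density

/-! ### Weak limits of sequences of vector-valued functions. -/

section WeakLimits

variable {Ω : Type*} {mΩ : MeasurableSpace Ω} {μ : Measure Ω}
  {Z : Type*} [NormedAddCommGroup Z] [NormedSpace ℝ Z]
  {X : Type*} [NormedAddCommGroup X] [NormedSpace ℝ X]

theorem exists_tendsto_of_abs_le {ι : Type*} (𝓤 : Ultrafilter ι) {a : ι → ℝ} {K : ℝ}
    (h : ∀ i, |a i| ≤ K) : ∃ x, Tendsto a 𝓤 (𝓝 x) := by
  obtain ⟨x, -, hx⟩ := (isCompact_Icc (a := -K) (b := K)).ultrafilter_le_nhds' (𝓤.map a)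
    (Ultrafilter.mem_map.2 (Filter.Eventually.of_forall fun i => abs_le.1 (h i)))
  exact ⟨x, hx⟩

theorem integrable_dual_apply {G : Ω → StrongDual ℝ Z} {w : Ω → Z} (hG : Integrable G μ)
    (hw : AEStronglyMeasurable w μ) {C : ℝ} (hb : ∀ᵐ ω ∂μ, ‖w ω‖ ≤ C) :
    Integrable (fun ω => G ω (w ω)) μ := by
  refine (hG.norm.mul_const C).mono' ((ContinuousLinearMap.id ℝ (StrongDual ℝ Z)).aestronglyMeasurable_comp₂
    hG.aestronglyMeasurable hw) ?_
  filter_upwards [hb] with ω hω using (G ω).le_opNorm_of_le hω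

theorem norm_integral_dual_apply_le {G : Ω → StrongDual ℝ Z} {w : Ω → Z} (hG : Integrable G μ)
    {C : ℝ} (hb : ∀ᵐ ω ∂μ, ‖w ω‖ ≤ C) : ‖∫ ω, G ω (w ω) ∂μ‖ ≤ (∫ ω, ‖G ω‖ ∂μ) * C := by
  rw [← integral_mul_const]
  refine norm_integral_le_of_norm_le (hG.norm.mul_const C) ?_
  filter_upwards [hb] with ω hω using (G ω).le_opNorm_of_le hω

theorem integrable_linearIsometry_comp (J : Z →ₗᵢ[ℝ] X) {w : Ω → Z} (hw : Integrable w μ) :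
    Integrable (fun ω => J (w ω)) μ :=
  J.toContinuousLinearMap.integrable_comp hw

/-- The element of `L_1(μ, X)` given by an integrable function into an isometric subspace. -/
def embedL1 (J : Z →ₗᵢ[ℝ] X) {w : Ω → Z} (hw : Integrable w μ) : Lp X 1 μ :=
  (integrable_linearIsometry_comp J hw).toL1 _

theorem coeFn_embedL1 (J : Z →ₗᵢ[ℝ] X) {w : Ω → Z} (hw : Integrable w μ) :
    embedL1 J hw =ᵐ[μ] fun ω => J (w ω) :=
  Integrable.coeFn_toL1 _

theorem embedL1_congr (J : Z →ₗᵢ[ℝ] X) {w w' : Ω → Z} (hw : Integrable w μ) (hw' : Integrable w' μ)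
    (h : w =ᵐ[μ] w') : embedL1 J hw = embedL1 J hw' :=
  (Integrable.toL1_eq_toL1_iff _ _ _ _).2 (by filter_upwards [h] with ω hω; rw [hω])

theorem norm_embedL1 (J : Z →ₗᵢ[ℝ] X) {w : Ω → Z} (hw : Integrable w μ) :
    ‖embedL1 J hw‖ = ∫ ω, ‖w ω‖ ∂μ := by
  rw [embedL1, L1.norm_of_fun_eq_integral_norm]
  simp only [J.norm_map]

theorem embedL1_add (J : Z →ₗᵢ[ℝ] X) {w w' : Ω → Z} (hw : Integrable w μ) (hw' : Integrable w' μ)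
    (h : Integrable (w + w') μ) : embedL1 J h = embedL1 J hw + embedL1 J hw' := by
  rw [embedL1, embedL1, embedL1, ← Integrable.toL1_add]
  refine (Integrable.toL1_eq_toL1_iff _ _ _ _).2 (ae_of_all _ fun ω => ?_)
  simp

theorem norm_embedL1_sub (J : Z →ₗᵢ[ℝ] X) {w w' : Ω → Z} (hw : Integrable w μ)
    (hw' : Integrable w' μ) : ‖embedL1 J hw - embedL1 J hw'‖ = ∫ ω, ‖w ω - w' ω‖ ∂μ := by
  rw [embedL1, embedL1, ← Integrable.toL1_sub, L1.norm_of_fun_eq_integral_norm]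
  simp only [Pi.sub_apply, ← map_sub, J.norm_map]

variable [IsFiniteMeasure μ]

/-- The limits of `∫_s d(u_i)` define a `Z**`-valued measure dominated by `C μ`; its density takes
values in `Z` by reflexivity and is the desired `v`. This handles indicator test functions, and the
uniform bound `C` carries the convergence to all integrable ones. -/
theorem exists_ultralimit_of_bounded [TopologicalSpace.SeparableSpace Z] (hZ : IsReflexive Z)
    {ι : Type*} (𝓤 : Ultrafilter ι) {u : ι → Ω → Z} (hu : ∀ i, StronglyMeasurable (u i)) {C : ℝ}
    (hC : 0 ≤ C) (hb : ∀ i ω, ‖u i ω‖ ≤ C) :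
    ∃ v : Ω → Z, StronglyMeasurable v ∧ (∀ ω, ‖v ω‖ ≤ C) ∧
      ∀ G : Ω → StrongDual ℝ Z, Integrable G μ →
        Tendsto (fun i => ∫ ω, G ω (u i ω) ∂μ) 𝓤 (𝓝 (∫ ω, G ω (v ω) ∂μ)) := by
  have hsep1 := hZ.separableSpace_dual
  have hsep2 : TopologicalSpace.SeparableSpace (StrongDual ℝ (StrongDual ℝ Z)) :=
    hZ.denseRange.separableSpace (NormedSpace.inclusionInDoubleDual ℝ Z).continuous
  have hbd : ∀ (d : StrongDual ℝ Z) (s : Set Ω) (i : ι),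
      |∫ ω in s, d (u i ω) ∂μ| ≤ C * ‖d‖ * μ.real s := fun d s i => by
    rw [mul_comm C]
    exact norm_setIntegral_le_of_norm_le_const (measure_lt_top μ s) fun ω _ =>
      d.le_opNorm_of_le (hb i ω)
  have hint : ∀ (d : StrongDual ℝ Z) (i : ι), Integrable (fun ω => d (u i ω)) μ := fun d i =>
    integrable_dual_apply (integrable_const d) (hu i).aestronglyMeasurable (ae_of_all _ (hb i))
  choose m hm using fun (d : StrongDual ℝ Z) (s : Set Ω) => exists_tendsto_of_abs_le 𝓤 (hbd d s)
  obtain ⟨g, hgm, hgb, hg⟩ := exists_dual_density (μ := μ) hC m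
    (fun d e s _ => tendsto_nhds_unique (hm _ _) <| by
      refine ((hm d s).add (hm e s)).congr fun i => ?_
      exact (integral_add (hint d i).integrableOn (hint e i).integrableOn).symm)
    (fun d s t hs ht hst => tendsto_nhds_unique (hm _ _) <| by
      refine ((hm d s).add (hm d t)).congr fun i => ?_
      exact (setIntegral_union hst ht (hint d i).integrableOn (hint d i).integrableOn).symm)
    (fun d s _ => le_of_tendsto (hm d s).abs (Eventually.of_forall (hbd d s)))
  let e : Z ≃ₗᵢ[ℝ] StrongDual ℝ (StrongDual ℝ Z) :=
    LinearIsometryEquiv.ofSurjective (NormedSpace.inclusionInDoubleDualLi ℝ) hZ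
  let v : Ω → Z := fun ω => e.symm (g ω)
  have hvm : StronglyMeasurable v := e.symm.continuous.comp_stronglyMeasurable hgm
  have hvb : ∀ ω, ‖v ω‖ ≤ C := fun ω => (e.symm.norm_map _).trans_le (hgb ω)
  have hvg : ∀ ω (d : StrongDual ℝ Z), d (v ω) = g ω d := fun ω d =>
    congrArg (fun φ : StrongDual ℝ (StrongDual ℝ Z) => φ d) (e.apply_symm_apply (g ω))
  have hgood : ∀ i, ∀ G : Ω → StrongDual ℝ Z, Integrable G μ → Integrable (fun ω => G ω (u i ω)) μ :=
    fun i G hG => integrable_dual_apply hG (hu i).aestronglyMeasurable (ae_of_all _ (hb i))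
  have hgood' : ∀ G : Ω → StrongDual ℝ Z, Integrable G μ → Integrable (fun ω => G ω (v ω)) μ :=
    fun G hG => integrable_dual_apply hG hvm.aestronglyMeasurable (ae_of_all _ hvb)
  refine ⟨v, hvm, hvb, fun G hG => ?_⟩
  refine Integrable.induction (P := fun G : Ω → StrongDual ℝ Z =>
    Tendsto (fun i => ∫ ω, G ω (u i ω) ∂μ) 𝓤 (𝓝 (∫ ω, G ω (v ω) ∂μ))) ?_ ?_ ?_ ?_ hG
  · intro c s hs _
    have h1 : ∀ w : Ω → Z, ∫ ω, (s.indicator (fun _ => c) ω) (w ω) ∂μ = ∫ ω in s, c (w ω) ∂μ := by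
      intro w
      rw [← integral_indicator hs]
      congr 1 with ω
      by_cases hω : ω ∈ s <;> simp [hω]
    simp only [h1]
    rw [show ∫ ω in s, c (v ω) ∂μ = m c s by simp only [hvg, hg c s hs]]
    exact hm c s
  · intro G H _ hG hH hGt hHt
    simp only [Pi.add_apply, add_apply]
    rw [integral_add (hgood' G hG) (hgood' H hH)]
    refine (hGt.add hHt).congr fun i => (integral_add (hgood i G hG) (hgood i H hH)).symm
  · refine isClosed_of_closure_subset fun G hG => ?_
    rw [Set.mem_ofPred_eq, Metric.tendsto_nhds]
    intro ε hε
    -- `C + 1` replaces `C`, which may be zero.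
    obtain ⟨H, hH, hGH⟩ := Metric.mem_closure_iff.1 hG (ε / (3 * (C + 1))) (by positivity)
    have hGi := L1.integrable_coeFn G
    have hHi := L1.integrable_coeFn H
    have hn : ∫ ω, ‖G ω - H ω‖ ∂μ = ‖G - H‖ := by
      rw [L1.norm_eq_integral_norm]
      refine integral_congr_ae ?_
      filter_upwards [Lp.coeFn_sub G H] with ω hω
      rw [hω, Pi.sub_apply]
    have key : ∀ w : Ω → Z, AEStronglyMeasurable w μ → (∀ ω, ‖w ω‖ ≤ C) →
        ‖∫ ω, G ω (w ω) ∂μ - ∫ ω, H ω (w ω) ∂μ‖ < ε / 3 := by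
      intro w hw hwb
      rw [← integral_sub (integrable_dual_apply hGi hw (ae_of_all _ hwb))
        (integrable_dual_apply hHi hw (ae_of_all _ hwb))]
      have h2 := norm_integral_dual_apply_le (μ := μ) (hGi.sub hHi) (ae_of_all μ hwb)
      simp only [Pi.sub_apply, sub_apply, hn] at h2
      refine h2.trans_lt ?_
      rw [dist_eq_norm, lt_div_iff₀ (by positivity)] at hGH
      nlinarith [norm_nonneg (G - H)]
    filter_upwards [Metric.tendsto_nhds.1 hH _ (show 0 < ε / 3 by positivity)] with i hi
    have h3 := key (u i) (hu i).aestronglyMeasurable (hb i)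
    have h4 := key v hvm.aestronglyMeasurable hvb
    rw [← dist_eq_norm] at h3 h4
    rw [dist_comm] at h4
    refine (dist_triangle4 _ _ _ _).trans_lt ((add_lt_add (add_lt_add h3 hi) h4).trans_eq ?_)
    ring
  · intro G H hGH _ hG
    have h1 : ∀ w : Ω → Z, ∫ ω, G ω (w ω) ∂μ = ∫ ω, H ω (w ω) ∂μ := fun w =>
      integral_congr_ae (by filter_upwards [hGH] with ω hω; rw [hω])
    simpa only [h1] using hG

/-- Functionals on `L_1(μ, Z)` are bounded `Z*`-valued functions: evaluating `Λ` on `z` times the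
indicator of `s` gives a `Z*`-valued measure dominated by `‖Λ‖ μ`, and `G` is its density. -/
theorem exists_dual_density_of_L1_dual [TopologicalSpace.SeparableSpace Z]
    [TopologicalSpace.SeparableSpace (StrongDual ℝ Z)] (J : Z →ₗᵢ[ℝ] X)
    (Λ : StrongDual ℝ (Lp X 1 μ)) :
    ∃ G : Ω → StrongDual ℝ Z, StronglyMeasurable G ∧ (∀ ω, ‖G ω‖ ≤ ‖Λ‖) ∧
      ∀ (w : Ω → Z) (hw : Integrable w μ), Λ (embedL1 J hw) = ∫ ω, G ω (w ω) ∂μ := by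
  classical
  have hci : ∀ (z : Z) (s : Set Ω), MeasurableSet s → Integrable (s.indicator fun _ => z) μ :=
    fun z s hs => (integrable_const z).indicator hs
  let m : Z → Set Ω → ℝ := fun z s =>
    if hs : MeasurableSet s then Λ (embedL1 J (hci z s hs)) else 0
  obtain ⟨G, hGm, hGb, hG⟩ := exists_dual_density (μ := μ) (norm_nonneg Λ) m
    (fun d e s hs => by
      simp only [m, dif_pos hs, ← map_add]
      rw [← embedL1_add _ _ _ ((hci d s hs).add (hci e s hs))]
      exact congrArg Λ (embedL1_congr _ _ _
        (Set.indicator_add s (fun _ => d) fun _ => e).eventuallyEq))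
    (fun d s t hs ht hst => by
      simp only [m, dif_pos hs, dif_pos ht, dif_pos (hs.union ht), ← map_add]
      rw [← embedL1_add _ _ _ ((hci d s hs).add (hci d t ht))]
      exact congrArg Λ
        (embedL1_congr _ _ _ (Set.indicator_union_of_disjoint hst _).eventuallyEq))
    (fun d s hs => by
      simp only [m, dif_pos hs]
      refine (Λ.le_opNorm _).trans_eq ?_
      rw [mul_assoc]
      congr 1
      rw [norm_embedL1]
      simp only [norm_indicator_eq_indicator_norm]
      rw [integral_indicator hs, setIntegral_const, smul_eq_mul, mul_comm])
  refine ⟨G, hGm, hGb, fun w hw => ?_⟩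
  have hGL : MemLp G ∞ μ := memLp_top_of_bound hGm.aestronglyMeasurable ‖Λ‖ (ae_of_all _ hGb)
  have hGae := hGL.coeFn_toLp
  have hGint : ∀ w : Ω → Z, Integrable w μ → Integrable (fun ω => G ω (w ω)) μ := fun w hw => by
    refine (hw.norm.const_mul ‖Λ‖).mono'
      ((ContinuousLinearMap.id ℝ (StrongDual ℝ Z)).aestronglyMeasurable_comp₂
        hGm.aestronglyMeasurable hw.aestronglyMeasurable) ?_
    exact ae_of_all _ fun ω => (G ω).le_of_opNorm_le (hGb ω) _
  refine Integrable.induction (P := fun w : Ω → Z => ∀ hw : Integrable w μ,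
    Λ (embedL1 J hw) = ∫ ω, G ω (w ω) ∂μ) ?_ ?_ ?_ ?_ hw hw
  · intro c s hs _ hw
    have h1 := hG c s hs
    simp only [m, dif_pos hs] at h1
    rw [← h1, ← integral_indicator hs]
    congr 1 with ω
    by_cases hω : ω ∈ s <;> simp [hω]
  · intro w w' _ hw hw' h h' hs
    rw [embedL1_add J hw hw', map_add, h hw, h' hw', ← integral_add (hGint _ hw) (hGint _ hw')]
    simp only [Pi.add_apply, map_add]
  -- Both sides are rewritten as continuous maps on `L_1(μ, Z)`, which makes the set where they
  -- agree closed.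
  · have h1 : ∀ w : Lp Z 1 μ, embedL1 J (L1.integrable_coeFn w) =
        J.toContinuousLinearMap.compLpL 1 μ w := by
      intro w
      refine Lp.ext ?_
      filter_upwards [coeFn_embedL1 J (L1.integrable_coeFn w),
        J.toContinuousLinearMap.coeFn_compLpL w] with ω h2 h3
      rw [h2, h3]
      rfl
    have h2 : ∀ w : Lp Z 1 μ, ∫ ω, G ω (w ω) ∂μ =
        (ContinuousLinearMap.id ℝ (StrongDual ℝ Z)).lpPairing μ ∞ 1 hGL.toLp w := by
      intro w
      rw [ContinuousLinearMap.lpPairing_eq_integral]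
      refine integral_congr_ae ?_
      filter_upwards [hGae] with ω hω
      rw [hω]; rfl
    have h3 : {w : Lp Z 1 μ | ∀ hw : Integrable w μ, Λ (embedL1 J hw) = ∫ ω, G ω (w ω) ∂μ} =
        {w : Lp Z 1 μ | Λ (J.toContinuousLinearMap.compLpL 1 μ w) =
          (ContinuousLinearMap.id ℝ (StrongDual ℝ Z)).lpPairing μ ∞ 1 hGL.toLp w} := by
      ext w
      rw [Set.mem_ofPred_eq, Set.mem_ofPred_eq, ← h1, ← h2]
      exact ⟨fun h => h _, fun h _ => h⟩
    rw [h3]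
    exact isClosed_eq (by fun_prop) (by fun_prop)
  · intro w w' hww' hw h hw'
    rw [← embedL1_congr J hw hw' hww', h hw]
    refine integral_congr_ae ?_
    filter_upwards [hww'] with ω hω
    rw [hω]

/-- Truncation at height `c` changes the functions by at most `ε` in `L_1`, and the truncated
functions are bounded, so they have a limit along the ultrafilter. -/
theorem exists_forall_dual_tendsto_of_uniformly_integrable [CompleteSpace X]
    [TopologicalSpace.SeparableSpace Z] (hZ : IsReflexive Z) (J : Z →ₗᵢ[ℝ] X) {ι : Type*}
    (𝓤 : Ultrafilter ι) {u : ι → Ω → Z} (hu : ∀ i, StronglyMeasurable (u i))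
    (hi : ∀ i, Integrable (u i) μ)
    (hUI : ∀ ε > 0, ∃ c : ℝ, ∀ᶠ i in 𝓤, ∫ ω in {ω | c < ‖u i ω‖}, ‖u i ω‖ ∂μ ≤ ε) :
    ∃ z : Lp X 1 μ, ∀ Λ : StrongDual ℝ (Lp X 1 μ),
      Tendsto (fun i => Λ (embedL1 J (hi i))) 𝓤 (𝓝 (Λ z)) := by
  have hsep1 := hZ.separableSpace_dual
  refine exists_forall_dual_tendsto_of_approx _ fun ε hε => ?_
  obtain ⟨c, hc⟩ := hUI ε hε
  have hms : ∀ i, MeasurableSet {ω | ‖u i ω‖ ≤ c} := fun i =>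
    measurableSet_le (hu i).norm.measurable measurable_const
  let v : ι → Ω → Z := fun i => {ω | ‖u i ω‖ ≤ c}.indicator (u i)
  have hvm : ∀ i, StronglyMeasurable (v i) := fun i => (hu i).indicator (hms i)
  have hvi : ∀ i, Integrable (v i) μ := fun i => (hi i).indicator (hms i)
  have hvb : ∀ i ω, ‖v i ω‖ ≤ max c 0 := by
    intro i ω
    by_cases h : ω ∈ {ω | ‖u i ω‖ ≤ c}
    · simp only [v, Set.indicator_of_mem h]; exact le_max_of_le_left h
    · simp only [v, Set.indicator_of_notMem h, norm_zero]; exact le_max_right _ _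
  obtain ⟨w, hwm, hwb, hw⟩ := exists_ultralimit_of_bounded (μ := μ) hZ 𝓤 hvm (le_max_right _ _) hvb
  have hwi : Integrable w μ := Integrable.of_bound hwm.aestronglyMeasurable _ (ae_of_all _ hwb)
  refine ⟨fun i => embedL1 J (hvi i), embedL1 J hwi, fun Λ => ?_, ?_⟩
  · obtain ⟨G, hGm, hGb, hG⟩ := exists_dual_density_of_L1_dual J Λ
    simp only [hG]
    exact hw G (Integrable.of_bound hGm.aestronglyMeasurable _ (ae_of_all _ hGb))
  · filter_upwards [hc] with i h1
    rw [norm_embedL1_sub]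
    refine le_of_eq_of_le ?_ h1
    rw [← integral_indicator (measurableSet_lt measurable_const (hu i).norm.measurable)]
    congr 1 with ω
    by_cases h : ‖u i ω‖ ≤ c
    · simp [v, h]
    · simp [v, h, not_le.1 h]

end WeakLimits

/-! ### Norming functions and the isometric embedding of `L_∞(Σ, X)`. -/

section Norming

variable {Ω : Type*} {mΩ : MeasurableSpace Ω} {μ : Measure Ω}
  {X : Type*} [NormedAddCommGroup X]

theorem ae_norm_le_norm_of_top (g : Lp X ∞ μ) : ∀ᵐ ω ∂μ, ‖g ω‖ ≤ ‖g‖ := by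
  filter_upwards [enorm_ae_le_eLpNormEssSup g μ] with ω hω
  rw [← eLpNorm_exponent_top] at hω
  rw [Lp.norm_def, ← toReal_enorm]
  exact ENNReal.toReal_mono (Lp.eLpNorm_ne_top g) hω

theorem exists_pos_forall_setIntegral_norm_le [IsFiniteMeasure μ] {h : Ω → X}
    (hh : Integrable h μ) {ε : ℝ} (hε : 0 < ε) :
    ∃ t > 0, ∀ s, MeasurableSet s → μ.real s ≤ t → ∫ ω in s, ‖h ω‖ ∂μ ≤ ε := by
  obtain ⟨t, ht, h1⟩ := (memLp_one_iff_integrable.2 hh).eLpNorm_indicator_le le_rfl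
    ENNReal.one_ne_top hε
  refine ⟨t, ht, fun s hs hst => ?_⟩
  have h2 := h1 s hs ((ENNReal.le_ofReal_iff_toReal_le (measure_ne_top μ s) ht.le).2 hst)
  rw [eLpNorm_indicator_eq_eLpNorm_restrict hs, eLpNorm_one_eq_lintegral_enorm] at h2
  rw [integral_norm_eq_lintegral_enorm hh.aestronglyMeasurable.restrict]
  exact ENNReal.toReal_le_of_le_ofReal hε.le h2

theorem exists_stronglyMeasurable_glue {B : ℕ → Set Ω} (hB : ∀ n, MeasurableSet (B n))
    (hdisj : Pairwise (Function.onFun Disjoint B)) {φ : ℕ → Ω → X}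
    (hφ : ∀ n, StronglyMeasurable (φ n)) {C : ℝ} (hC : 0 ≤ C) (hb : ∀ n ω, ‖φ n ω‖ ≤ C) :
    ∃ ψ : Ω → X, StronglyMeasurable ψ ∧ (∀ ω, ‖ψ ω‖ ≤ C) ∧ ∀ n, ∀ ω ∈ B n, ψ ω = φ n ω := by
  have hmem : ∀ n, ∀ ω ∈ B n, HasSum (fun k => (B k).indicator (φ k) ω) (φ n ω) := by
    intro n ω hω
    rw [← Set.indicator_of_mem hω (φ n)]
    refine hasSum_single n fun k hk => Set.indicator_of_notMem (fun hk' => ?_) _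
    exact Set.disjoint_left.1 (hdisj hk) hk' hω
  have hnot : ∀ ω, (∀ n, ω ∉ B n) → HasSum (fun k => (B k).indicator (φ k) ω) 0 := by
    intro ω hω
    simp only [Set.indicator_of_notMem (hω _)]
    exact hasSum_zero
  refine ⟨fun ω => ∑' k, (B k).indicator (φ k) ω, ?_, fun ω => ?_, fun n ω hω =>
    (hmem n ω hω).tsum_eq⟩
  · refine stronglyMeasurable_of_tendsto atTop
      (fun n => Finset.stronglyMeasurable_sum (Finset.range n)
        fun k _ => (hφ k).indicator (hB k)) (tendsto_pi_nhds.2 fun ω => ?_)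
    simp only [Finset.sum_apply]
    by_cases hω : ∃ n, ω ∈ B n
    · obtain ⟨n, hn⟩ := hω
      exact (hmem n ω hn).summable.hasSum.tendsto_sum_nat
    · push Not at hω
      exact (hnot ω hω).summable.hasSum.tendsto_sum_nat
  · by_cases hω : ∃ n, ω ∈ B n
    · obtain ⟨n, hn⟩ := hω
      beta_reduce
      rw [(hmem n ω hn).tsum_eq]
      exact hb n ω
    · push Not at hω
      beta_reduce
      rw [(hnot ω hω).tsum_eq, norm_zero]
      exact hC

variable [NormedSpace ℝ X]

/-- A measurable choice of norming functionals is immediate for a simple function, which has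
finitely many values. Replacing `h` by a simple `s` costs at most `2‖h - s‖` pointwise. -/
theorem exists_norming_of_integrable {h : Ω → X} (hh : Integrable h μ) {ε : ℝ} (hε : 0 < ε) :
    ∃ φ : Ω → StrongDual ℝ X, StronglyMeasurable φ ∧ (∀ ω, ‖φ ω‖ ≤ 1) ∧
      ∫ ω, ‖h ω‖ ∂μ ≤ (∫ ω, φ ω (h ω) ∂μ) + ε := by
  obtain ⟨s, hs, hsL⟩ := (memLp_one_iff_integrable.2 hh).exists_simpleFunc_eLpNorm_sub_lt
    ENNReal.one_ne_top (ε := ENNReal.ofReal (ε / 2)) (by simpa using hε)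
  have hsi : Integrable s μ := memLp_one_iff_integrable.1 hsL
  have hsn : ∫ ω, ‖h ω - s ω‖ ∂μ ≤ ε / 2 := by
    rw [eLpNorm_one_eq_lintegral_enorm] at hs
    rw [integral_norm_eq_lintegral_enorm (f := fun ω => h ω - s ω)
      (hh.sub hsi).aestronglyMeasurable]
    exact ENNReal.toReal_le_of_le_ofReal (half_pos hε).le hs.le
  choose D hD hDx using fun x : X => exists_dual_vector'' ℝ x
  refine ⟨fun ω => D (s ω), (s.map D).stronglyMeasurable, fun ω => hD _, ?_⟩
  have hpt : ∀ ω, ‖h ω‖ ≤ D (s ω) (h ω) + 2 * ‖h ω - s ω‖ := by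
    intro ω
    have h1 : |D (s ω) (h ω - s ω)| ≤ 1 * ‖h ω - s ω‖ := (D (s ω)).le_of_opNorm_le (hD _) _
    have h2 : D (s ω) (s ω) = ‖s ω‖ := hDx _
    have h3 := norm_le_insert' (h ω) (s ω)
    rw [map_sub, h2] at h1
    have := (abs_le.1 h1).1
    linarith
  have hDi : Integrable (fun ω => D (s ω) (h ω)) μ := by
    refine hh.norm.mono' ((ContinuousLinearMap.id ℝ (StrongDual ℝ X)).aestronglyMeasurable_comp₂
      (s.map D).aestronglyMeasurable hh.aestronglyMeasurable) (ae_of_all _ fun ω => ?_)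
    exact ((D (s ω)).le_of_opNorm_le (hD _) _).trans_eq (one_mul _)
  calc ∫ ω, ‖h ω‖ ∂μ ≤ ∫ ω, (D (s ω) (h ω) + 2 * ‖h ω - s ω‖) ∂μ :=
        integral_mono hh.norm (hDi.add ((hh.sub hsi).norm.const_mul 2)) hpt
    _ = (∫ ω, D (s ω) (h ω) ∂μ) + 2 * ∫ ω, ‖h ω - s ω‖ ∂μ := by
        rw [← integral_const_mul]
        exact integral_add hDi ((hh.sub hsi).norm.const_mul 2)
    _ ≤ _ := by linarith

theorem integrable_bounded_dual_apply {φ : Ω → StrongDual ℝ X} {h : Ω → X}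
    (hφ : StronglyMeasurable φ) (hb : ∀ ω, ‖φ ω‖ ≤ 1) (hh : Integrable h μ) :
    Integrable (fun ω => φ ω (h ω)) μ := by
  refine hh.norm.mono' ((ContinuousLinearMap.id ℝ (StrongDual ℝ X)).aestronglyMeasurable_comp₂
    hφ.aestronglyMeasurable hh.aestronglyMeasurable) (ae_of_all _ fun ω => ?_)
  exact ((φ ω).le_of_opNorm_le (hb _) _).trans_eq (one_mul _)

theorem abs_setIntegral_bounded_dual_apply_le {φ : Ω → StrongDual ℝ X} {h : Ω → X}
    (hb : ∀ ω, ‖φ ω‖ ≤ 1) (hh : Integrable h μ) (s : Set Ω) :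
    |∫ ω in s, φ ω (h ω) ∂μ| ≤ ∫ ω in s, ‖h ω‖ ∂μ :=
  norm_integral_le_of_norm_le hh.norm.integrableOn
    (ae_of_all _ fun ω => ((φ ω).le_of_opNorm_le (hb _) _).trans_eq (one_mul _))

theorem exists_dual_eq_setIntegral [IsFiniteMeasure μ] {φ : Ω → StrongDual ℝ X}
    (hφ : StronglyMeasurable φ) (hb : ∀ ω, ‖φ ω‖ ≤ 1) {s : Set Ω} (hs : MeasurableSet s) :
    ∃ Λ : StrongDual ℝ (Lp X 1 μ), ∀ h, Λ h = ∫ ω in s, φ ω (h ω) ∂μ := by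
  have hL : MemLp (s.indicator φ) ∞ μ :=
    (memLp_top_of_bound hφ.aestronglyMeasurable 1 (ae_of_all μ hb)).indicator hs
  refine ⟨(ContinuousLinearMap.id ℝ (StrongDual ℝ X)).lpPairing μ ∞ 1 hL.toLp, fun h => ?_⟩
  rw [ContinuousLinearMap.lpPairing_eq_integral, ← integral_indicator hs]
  refine integral_congr_ae ?_
  filter_upwards [hL.coeFn_toLp] with ω hω
  rw [hω]
  by_cases hωs : ω ∈ s <;> simp [hωs]

/-- For the lower bound, testing against almost norming functions supported in `s` gives `∫_s ‖g‖ ≤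
K μ(s)` for every measurable `s`, hence `‖g‖ ≤ K` almost everywhere. -/
theorem norm_pairing_inclusionInDoubleDual [IsFiniteMeasure μ] (g : Lp X ∞ μ) :
    ‖pairing (NormedSpace.inclusionInDoubleDual ℝ X) μ g‖ = ‖g‖ := by
  refine le_antisymm ?_ ?_
  · refine ContinuousLinearMap.opNorm_le_bound _ (norm_nonneg g) fun φ => ?_
    rw [pairing_apply, L1.norm_eq_integral_norm, mul_comm]
    exact norm_integral_dual_apply_le (L1.integrable_coeFn φ) (ae_norm_le_norm_of_top g)
  let Φ := pairing (NormedSpace.inclusionInDoubleDual ℝ X) μ g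
  let K : ℝ := ‖Φ‖
  have hK : 0 ≤ K := norm_nonneg Φ
  have hgi : Integrable g μ := memLp_one_iff_integrable.1 ((Lp.memLp g).mono_exponent le_top)
  have hset : ∀ s, MeasurableSet s → ∫ ω in s, ‖g ω‖ ∂μ ≤ K * μ.real s := by
    intro s hs
    refine le_of_forall_pos_le_add fun ε hε => ?_
    obtain ⟨φ, hφm, hφb, hφ⟩ := exists_norming_of_integrable (μ := μ.restrict s) hgi.restrict hε
    have hφi : Integrable (s.indicator φ) μ :=
      (Integrable.of_bound hφm.aestronglyMeasurable 1 (ae_of_all _ hφb)).indicator hs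
    refine hφ.trans (add_le_add_left ?_ ε)
    have h1 : pairing (NormedSpace.inclusionInDoubleDual ℝ X) μ g (hφi.toL1 _) =
        ∫ ω in s, φ ω (g ω) ∂μ := by
      rw [pairing_apply, ← integral_indicator hs]
      refine integral_congr_ae ?_
      filter_upwards [hφi.coeFn_toL1] with ω hω
      rw [hω, NormedSpace.dual_def]
      by_cases hωs : ω ∈ s <;> simp [hωs]
    have h2 : ‖hφi.toL1 _‖ ≤ μ.real s := by
      rw [L1.norm_of_fun_eq_integral_norm]
      simp only [norm_indicator_eq_indicator_norm]
      rw [integral_indicator hs]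
      refine (integral_mono_of_nonneg (ae_of_all _ fun _ => norm_nonneg _)
        (integrable_const (1 : ℝ)) (ae_of_all _ hφb)).trans_eq ?_
      simp
    rw [← h1]
    exact (le_abs_self _).trans ((Φ.le_opNorm _).trans (mul_le_mul_of_nonneg_left h2 hK))
  have hae : ∀ᵐ ω ∂μ, ‖g ω‖ ≤ K :=
    (ae_abs_le_of_forall_abs_setIntegral_le hgi.norm fun s hs => by
      rw [abs_of_nonneg (integral_nonneg fun _ => norm_nonneg _)]
      exact hset s hs).mono fun ω hω => (le_abs_self _).trans hω
  simpa using Lp.norm_le_of_ae_bound hK hae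

end Norming

/-! ### Uniform integrability of weakly compact sets in `L_1`. -/

section UniformIntegrability

variable {Ω : Type*} {mΩ : MeasurableSpace Ω} {μ : Measure Ω} [IsFiniteMeasure μ]
  {X : Type*} [NormedAddCommGroup X] [NormedSpace ℝ X]

theorem measureReal_iUnion_add_le {A : ℕ → Set Ω} {t : ℕ → ℝ} (ht : ∀ n, 0 ≤ t n)
    (hA : ∀ n, μ.real (A n) ≤ t n) (hhalf : ∀ n, t (n + 1) ≤ t n / 2) (m : ℕ) :
    μ.real (⋃ k, A (m + k)) ≤ 2 * t m := by
  have hgeo : ∀ k, t (m + k) ≤ t m * (1 / 2) ^ k := by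
    intro k
    induction k with
    | zero => simp
    | succ k ih => rw [← add_assoc, pow_succ]; linarith [hhalf (m + k)]
  refine ENNReal.toReal_le_of_le_ofReal (by linarith [ht m]) ?_
  calc μ (⋃ k, A (m + k)) ≤ ∑' k, μ (A (m + k)) := measure_iUnion_le _
    _ ≤ ∑' k, ENNReal.ofReal (t m * (1 / 2) ^ k) := ENNReal.tsum_le_tsum fun k =>
        (ENNReal.le_ofReal_iff_toReal_le (measure_ne_top _ _)
          (mul_nonneg (ht m) (by positivity))).2 ((hA _).trans (hgeo k))
    _ = ENNReal.ofReal (2 * t m) := by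
        rw [← ENNReal.ofReal_tsum_of_nonneg (fun k => mul_nonneg (ht m) (by positivity))
          (summable_geometric_two.mul_left _), tsum_mul_left, tsum_geometric_two, mul_comm]

/-- Weakly compact subsets of `L_1` are uniformly integrable. -/
theorem IsWeaklyCompact.exists_pos_forall_setIntegral_norm_le {F : Set (Lp X 1 μ)}
    (hF : IsWeaklyCompact F) {ε : ℝ} (hε : 0 < ε) :
    ∃ t > 0, ∀ a ∈ F, ∀ s, MeasurableSet s → μ.real s ≤ t → ∫ ω in s, ‖a ω‖ ∂μ ≤ ε := by
  by_contra hcon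
  have hint : ∀ a : Lp X 1 μ, Integrable a μ := fun a => L1.integrable_coeFn a
  -- The infimum `η` of `S` is the mass that elements of `F` can concentrate on arbitrarily small
  -- sets. A gliding hump built from it contradicts weak compactness.
  let S : Set ℝ := {r | ∃ t > 0, ∀ a ∈ F, ∀ s, MeasurableSet s → μ.real s ≤ t →
    ∫ ω in s, ‖a ω‖ ∂μ ≤ r}
  have hSup : ∀ r ∈ S, ∀ r', r ≤ r' → r' ∈ S := fun r ⟨t, ht, h⟩ r' hr =>
    ⟨t, ht, fun a ha s hs hst => (h a ha s hs hst).trans hr⟩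
  have hSlb : ∀ r ∈ S, ε ≤ r := fun r hr => by
    by_contra hlt
    exact hcon (hSup r hr ε (not_le.1 hlt).le)
  have hSne : S.Nonempty := by
    obtain ⟨M, hM⟩ := isBounded_iff_forall_norm_le.1 hF.isBounded
    refine ⟨M, 1, one_pos, fun a ha s hs _ => ?_⟩
    refine (setIntegral_le_integral (hint a).norm (ae_of_all _ fun _ => norm_nonneg _)).trans ?_
    rw [← L1.norm_eq_integral_norm]
    exact hM a ha
  set η := sInf S
  have hη : ε ≤ η := le_csInf hSne hSlb
  set e := η / 8 with he
  have hep : 0 < e := by linarith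
  obtain ⟨T, hT, hTF⟩ : η + e ∈ S := by
    obtain ⟨r, hr, hr'⟩ := exists_lt_of_csInf_lt hSne (show sInf S < η + e by linarith)
    exact hSup r hr _ hr'.le
  have hbad : ∀ t : ℝ, 0 < t → ∃ (a : Lp X 1 μ) (s : Set Ω), a ∈ F ∧ MeasurableSet s ∧
      μ.real s ≤ t ∧ η - e < ∫ ω in s, ‖a ω‖ ∂μ := by
    intro t ht
    by_contra hno
    push Not at hno
    have : η - e ∈ S := ⟨t, ht, fun a ha s hs hst => hno a s ha hs hst⟩
    have := csInf_le ⟨ε, hSlb⟩ this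
    linarith
  choose! α A₀ hαF hA₀m hA₀t hA₀ using hbad
  choose τ hτ hτa using fun a : Lp X 1 μ =>
    FCenter.exists_pos_forall_setIntegral_norm_le (hint a) hep
  -- Halving makes the tail unions `U m` have measure at most `2 * t m`, and starting at `T / 2`
  -- keeps this below `T`. The bound by `τ / 2` leaves `a n` at most mass `e` on `U (n + 1)`, so the
  -- disjoint sets `B n` still carry almost all the concentrated mass.
  let t : ℕ → ℝ := fun n => Nat.rec (T / 2) (fun _ s => min (s / 2) (τ (α s) / 2)) n
  have ht_succ : ∀ n, t (n + 1) = min (t n / 2) (τ (α (t n)) / 2) := fun n => rfl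
  have htp : ∀ n, 0 < t n := by
    intro n
    induction n with
    | zero => exact half_pos hT
    | succ n ih => rw [ht_succ]; exact lt_min (half_pos ih) (half_pos (hτ _))
  have hhalf : ∀ n, t (n + 1) ≤ t n / 2 := fun n => (ht_succ n).trans_le (min_le_left _ _)
  let a : ℕ → Lp X 1 μ := fun n => α (t n)
  let A : ℕ → Set Ω := fun n => A₀ (t n)
  have haF : ∀ n, a n ∈ F := fun n => hαF _ (htp n)
  have hAm : ∀ n, MeasurableSet (A n) := fun n => hA₀m _ (htp n)
  let U : ℕ → Set Ω := fun m => ⋃ k, A (m + k)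
  have hUm : ∀ m, MeasurableSet (U m) := fun m => MeasurableSet.iUnion fun k => hAm _
  have hUt : ∀ m, μ.real (U m) ≤ 2 * t m := fun m =>
    measureReal_iUnion_add_le (fun n => (htp n).le) (fun n => hA₀t _ (htp n)) hhalf m
  have hAU : ∀ m n, m ≤ n → A n ⊆ U m := fun m n hmn => by
    obtain ⟨k, rfl⟩ := Nat.exists_eq_add_of_le hmn
    exact Set.subset_iUnion (fun k => A (m + k)) k
  have ht_anti : Antitone t := antitone_nat_of_succ_le fun n => by linarith [hhalf n, htp n]
  have hUa : ∀ m n, ∫ ω in U m, ‖a n ω‖ ∂μ ≤ η + e := fun m n => by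
    refine hTF _ (haF n) _ (hUm m) ((hUt m).trans ?_)
    have h0 : t 0 = T / 2 := rfl
    linarith [ht_anti (Nat.zero_le m)]
  let B : ℕ → Set Ω := fun n => A n \ U (n + 1)
  have hBm : ∀ n, MeasurableSet (B n) := fun n => (hAm n).diff (hUm _)
  have hdisj : Pairwise (Function.onFun Disjoint B) := by
    rw [pairwise_disjoint_on]
    intro m n hmn
    refine Set.disjoint_left.2 fun ω hω hω' => hω.2 (hAU _ _ hmn hω'.1)
  have hBa : ∀ n, η - 2 * e ≤ ∫ ω in B n, ‖a n ω‖ ∂μ := by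
    intro n
    have h1 := hA₀ _ (htp n)
    have h2 : ∫ ω in U (n + 1), ‖a n ω‖ ∂μ ≤ e := by
      refine hτa _ _ (hUm _) ((hUt _).trans ?_)
      have := (ht_succ n).trans_le (min_le_right _ _)
      change 2 * t (n + 1) ≤ τ (α (t n))
      linarith
    have h3 : ∫ ω in A n, ‖a n ω‖ ∂μ = (∫ ω in A n ∩ U (n + 1), ‖a n ω‖ ∂μ) +
        ∫ ω in B n, ‖a n ω‖ ∂μ :=
      (integral_inter_add_sdiff (hUm _) (hint _).norm.integrableOn).symm
    have h4 : ∫ ω in A n ∩ U (n + 1), ‖a n ω‖ ∂μ ≤ ∫ ω in U (n + 1), ‖a n ω‖ ∂μ :=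
      setIntegral_mono_set (hint _).norm.integrableOn (ae_of_all _ fun _ => norm_nonneg _)
        (ae_of_all _ fun ω hω => hω.2)
    change η - e < ∫ ω in A n, ‖a n ω‖ ∂μ at h1
    linarith
  choose φ hφm hφb hφ using fun n => exists_norming_of_integrable (μ := μ.restrict (B n))
    (hint (a n)).restrict hep
  obtain ⟨ψ, hψm, hψb, hψ⟩ := exists_stronglyMeasurable_glue hBm hdisj hφm zero_le_one hφb
  have hψi : ∀ h : Lp X 1 μ, Integrable (fun ω => ψ ω (h ω)) μ := fun h =>
    integrable_bounded_dual_apply hψm hψb (hint h)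
  -- One `ψ` almost norms every `a n` on its own `B n`. On `U m` the total mass of `a n` is at most
  -- `η + e` and at least `η - 2 * e` lies in `B n`, so the integral is at least `η - 6 * e`, which
  -- is `η / 4`.
  have hlow : ∀ m n, m ≤ n → η / 4 ≤ ∫ ω in U m, ψ ω (a n ω) ∂μ := by
    intro m n hmn
    have hBU : U m ∩ B n = B n := Set.inter_eq_right.2 (Set.sdiff_subset.trans (hAU m n hmn))
    have h1 : ∫ ω in U m, ψ ω (a n ω) ∂μ = (∫ ω in B n, ψ ω (a n ω) ∂μ) +
        ∫ ω in U m \ B n, ψ ω (a n ω) ∂μ := by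
      rw [← integral_inter_add_sdiff (hBm n) (hψi _).integrableOn, hBU]
    have h2 : ∫ ω in U m, ‖a n ω‖ ∂μ = (∫ ω in B n, ‖a n ω‖ ∂μ) +
        ∫ ω in U m \ B n, ‖a n ω‖ ∂μ := by
      rw [← integral_inter_add_sdiff (hBm n) (hint _).norm.integrableOn, hBU]
    have h3 := (abs_le.1 (abs_setIntegral_bounded_dual_apply_le hψb (hint (a n)) (U m \ B n))).1
    have h4 : ∫ ω in B n, ψ ω (a n ω) ∂μ = ∫ ω in B n, φ n ω (a n ω) ∂μ :=
      setIntegral_congr_fun (hBm n) fun ω hω => by simp only [hψ n ω hω]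
    have h5 := hφ n
    have h6 := hUa m n
    have h7 := hBa n
    linarith
  choose Λ hΛ using fun m => exists_dual_eq_setIntegral (μ := μ) hψm hψb (hUm m)
  -- A weak limit `b` inherits the lower bound `η / 4` on every `U m`, although `μ (U m)` tends to
  -- zero and `b` is integrable.
  obtain ⟨_, ⟨b, -, rfl⟩, hb⟩ := hF.ultrafilter_le_nhds'
    ((hyperfilter ℕ).map fun n => toWeakSpace ℝ (Lp X 1 μ) (a n))
    (Ultrafilter.mem_map.2 (Filter.Eventually.of_forall fun n => ⟨_, haF n, rfl⟩))
  have hlim : ∀ m, Tendsto (fun n => Λ m (a n)) (hyperfilter ℕ) (𝓝 (Λ m b)) := fun m =>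
    dual_tendsto_of_tendsto_toWeakSpace hb (Λ m)
  have hlow' : ∀ m, η / 4 ≤ ∫ ω in U m, ψ ω (b ω) ∂μ := by
    intro m
    rw [← hΛ]
    refine ge_of_tendsto (hlim m) ?_
    filter_upwards [Nat.hyperfilter_le_atTop (eventually_ge_atTop m)] with n hn
    rw [hΛ]
    exact hlow m n hn
  have htlim : Tendsto t atTop (𝓝 0) := by
    refine squeeze_zero (fun n => (htp n).le) (g := fun n => t 0 * (1 / 2) ^ n) (fun n => ?_) ?_
    · induction n with
      | zero => simp
      | succ n ih => rw [pow_succ]; linarith [hhalf n]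
    · simpa using (tendsto_pow_atTop_nhds_zero_of_lt_one (r := (1 / 2 : ℝ)) (by norm_num)
        (by norm_num)).const_mul (t 0)
  obtain ⟨m, hm⟩ := (htlim.eventually_lt_const (half_pos (hτ b))).exists
  have h1 := hτa b (U m) (hUm m) ((hUt m).trans (by linarith))
  have h2 := (le_abs_self _).trans (abs_setIntegral_bounded_dual_apply_le hψb (hint b) (U m))
  linarith [hlow' m]

end UniformIntegrability

/-! ### Minimizing sequences and the extraction of a diagonal subsequence. -/

section Centers

variable {E : Type*} [NormedAddCommGroup E]

theorem rFam_le_rFam {B : Type*} {f : EllInfNonneg B → ℝ≥0} (hf : Monotone f) {a : B → E}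
    {ha : Bornology.IsBounded (Set.range a)} {x y : E} (h : ∀ b, ‖x - a b‖ ≤ ‖y - a b‖) :
    rFam f a ha x ≤ rFam f a ha y :=
  hf h

theorem rFam_congr {E' : Type*} [NormedAddCommGroup E'] {B : Type*} (f : EllInfNonneg B → ℝ≥0)
    {a : B → E} {a' : B → E'} {ha : Bornology.IsBounded (Set.range a)}
    {ha' : Bornology.IsBounded (Set.range a')} {x : E} {x' : E'}
    (h : ∀ b, ‖x - a b‖ = ‖x' - a' b‖) : rFam f a ha x = rFam f a' ha' x' :=
  congrArg f (Subtype.ext (Subtype.ext (funext h)))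

theorem Coercive.exists_norm_le {B : Type*} [Nonempty B] {f : EllInfNonneg B → ℝ≥0}
    (hf : Coercive f) {a : B → E} (ha : Bornology.IsBounded (Set.range a)) (R : ℝ≥0) :
    ∃ M, 0 ≤ M ∧ ∀ x, rFam f a ha x ≤ R → ‖x‖ ≤ M := by
  obtain ⟨S, hS, hSf⟩ := mem_comap.1 (hf (eventually_gt_atTop R))
  obtain ⟨N, hN⟩ := mem_atTop_sets.1 hS
  obtain ⟨b⟩ := ‹Nonempty B›
  refine ⟨max N 0 + ‖a b‖, by positivity, fun x hx => ?_⟩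
  by_contra hlt
  push Not at hlt
  have h1 : ‖x - a b‖ ≤ ‖(distTuple a ha x).1‖ := by
    have := lp.norm_apply_le_norm ENNReal.top_ne_zero (distTuple a ha x).1 b
    rwa [show (distTuple a ha x).1 b = ‖x - a b‖ from rfl, norm_norm] at this
  have h2 := norm_le_norm_add_norm_sub' x (a b)
  have h3 : N ≤ ‖(distTuple a ha x).1‖ := by linarith [le_max_left N 0]
  have h4 : R < f (distTuple a ha x) := hSf (hN _ h3)
  exact absurd hx (not_le.2 h4)

variable [NormedSpace ℝ E]

theorem exists_minimizing_seq {F : Set E} (hF : Bornology.IsBounded F)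
    (f : EllInfNonneg F → ℝ≥0) (V : Submodule ℝ E) :
    ∃ x : ℕ → E, (∀ n, x n ∈ V) ∧ ∀ n : ℕ, r hF f (x n) ≤ rad hF f V + 1 / (n + 1) := by
  have h : ∀ n : ℕ, ∃ y : V, r hF f (y : E) < rad hF f V + 1 / (n + 1) := fun n =>
    exists_lt_of_ciInf_lt (lt_add_of_pos_right _ Nat.one_div_pos_of_nat)
  choose y hy using h
  exact ⟨fun n => y n, fun n => (y n).2, fun n => (hy n).le⟩

/-- Semicontinuity is required only at `z` along `l`, so the weak and the weak-star case are both
covered. -/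
theorem mem_cent_of_eventually_lt {F : Set E} {hF : Bornology.IsBounded F}
    {f : EllInfNonneg F → ℝ≥0} {V : Submodule ℝ E} {z : E} (hz : z ∈ V) {x : ℕ → E}
    {l : Filter ℕ} [l.NeBot] (hl : l ≤ atTop)
    (hx : ∀ᶠ k : ℕ in l, r hF f (x k) ≤ rad hF f V + 1 / (k + 1))
    (hlsc : ∀ c < r hF f z, ∀ᶠ k in l, c < r hF f (x k)) : z ∈ cent hF f V := by
  refine ⟨hz, le_antisymm ?_ (ciInf_le (OrderBot.bddBelow _) (⟨z, hz⟩ : V))⟩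
  by_contra hlt
  obtain ⟨c, hc, hcz⟩ := exists_between (not_le.1 hlt)
  have hlim : Tendsto (fun k : ℕ => rad hF f V + 1 / ((k : ℝ≥0) + 1)) l (𝓝 (rad hF f V)) := by
    simpa using (tendsto_const_nhds.add (tendsto_one_div_add_atTop_nhds_zero_nat (𝕜 := ℝ≥0))).mono_left
      hl
  obtain ⟨k, h1, h2, h3⟩ := (hx.and ((hlim.eventually_lt_const hc).and (hlsc c hcz))).exists
  exact absurd (h3.trans_le h1) (not_lt.2 h2.le)

end Centers

/-- The ultrafilter limits `L j` of `I n j` decrease to `η`; `σ k` is chosen so that `I (σ k) j` is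
within `1 / (k + 1)` of `L j` for all `j ≤ k`. For tail integrals, `η` is the escaping mass, and the
last clause says that cutting at height `k` leaves a uniformly integrable sequence. -/
theorem exists_subseq_tendsto_diagonal {I : ℕ → ℕ → ℝ} (hI0 : ∀ n j, 0 ≤ I n j)
    (hanti : ∀ n, Antitone (I n)) {M : ℝ} (hM : ∀ n j, I n j ≤ M) :
    ∃ (η : ℝ) (σ : ℕ → ℕ), 0 ≤ η ∧ (∀ k, k ≤ σ k) ∧
      Tendsto (fun k => I (σ k) k) atTop (𝓝 η) ∧
      ∀ ε > 0, ∃ j : ℕ, ∀ᶠ k in atTop, I (σ k) j - I (σ k) k ≤ ε := by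
  choose L hL using fun j => exists_tendsto_of_abs_le (hyperfilter ℕ) (a := fun n => I n j)
    fun n => (abs_of_nonneg (hI0 n j)).trans_le (hM n j)
  have hL0 : ∀ j, 0 ≤ L j := fun j => ge_of_tendsto' (hL j) fun n => hI0 n j
  have hLanti : Antitone L := fun i j hij =>
    le_of_tendsto_of_tendsto' (hL j) (hL i) fun n => hanti n hij
  have hLlim : Tendsto L atTop (𝓝 (⨅ j, L j)) :=
    tendsto_atTop_ciInf hLanti ⟨0, by rintro _ ⟨j, rfl⟩; exact hL0 j⟩
  have hε : ∀ k : ℕ, (0 : ℝ) < 1 / (k + 1) := fun k => Nat.one_div_pos_of_nat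
  have hex : ∀ k : ℕ, ∃ n, k ≤ n ∧ ∀ j ∈ Finset.range (k + 1), dist (I n j) (L j) < 1 / (k + 1) := by
    intro k
    have h1 : ∀ᶠ n in (hyperfilter ℕ : Filter ℕ), k ≤ n :=
      Nat.hyperfilter_le_atTop (eventually_ge_atTop k)
    have h2 : ∀ᶠ n in (hyperfilter ℕ : Filter ℕ),
        ∀ j ∈ Finset.range (k + 1), dist (I n j) (L j) < 1 / (k + 1) :=
      (Finset.eventually_all _).2 fun j _ => Metric.tendsto_nhds.1 (hL j) _ (hε k)
    exact (h1.and h2).exists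
  choose σ hσ hσd using hex
  have hlim := tendsto_one_div_add_atTop_nhds_zero_nat (𝕜 := ℝ)
  have hfix : ∀ j, Tendsto (fun k => I (σ k) j) atTop (𝓝 (L j)) := by
    intro j
    rw [tendsto_iff_dist_tendsto_zero]
    refine squeeze_zero' (Eventually.of_forall fun _ => dist_nonneg) ?_ hlim
    filter_upwards [eventually_ge_atTop j] with k hk
    exact (hσd k j (Finset.mem_range.2 (Nat.lt_succ_of_le hk))).le
  have hdiag : Tendsto (fun k => I (σ k) k) atTop (𝓝 (⨅ j, L j)) := by
    have h0 : Tendsto (fun k => I (σ k) k - L k) atTop (𝓝 0) := by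
      refine squeeze_zero_norm (fun k => ?_) hlim
      rw [← dist_eq_norm]
      exact (hσd k k (Finset.mem_range.2 (Nat.lt_succ_self k))).le
    simpa using h0.add hLlim
  refine ⟨⨅ j, L j, σ, le_ciInf hL0, hσ, hdiag, fun ε hεp => ?_⟩
  obtain ⟨j, hj⟩ := (hLlim.eventually_lt_const (lt_add_of_pos_right _ hεp)).exists
  refine ⟨j, ?_⟩
  have := ((hfix j).sub hdiag).eventually_lt_const (show L j - ⨅ j, L j < ε by linarith)
  exact this.mono fun k hk => hk.le

/-! ### The subspaces `L_p(Σ', Y)`. -/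

section Subspaces

variable {Ω : Type*}

theorem exists_separable_factorization {Y : Type*} [NormedAddCommGroup Y] [NormedSpace ℝ Y]
    {m : MeasurableSpace Ω} {u : ℕ → Ω → Y} (hu : ∀ n, StronglyMeasurable (u n)) :
    ∃ Z : Submodule ℝ Y, IsClosed (Z : Set Y) ∧ TopologicalSpace.SeparableSpace Z ∧
      ∃ w : ℕ → Ω → Z, (∀ n, StronglyMeasurable (w n)) ∧ ∀ n ω, (w n ω : Y) = u n ω := by
  let Z : Submodule ℝ Y := (Submodule.span ℝ (⋃ n, Set.range (u n))).topologicalClosure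
  have hmem : ∀ n ω, u n ω ∈ Z := fun n ω => Submodule.le_topologicalClosure _
    (Submodule.subset_span (Set.mem_iUnion.2 ⟨n, ω, rfl⟩))
  have hsep : TopologicalSpace.IsSeparable (Z : Set Y) :=
    (TopologicalSpace.IsSeparable.iUnion fun n => (hu n).isSeparable_range).span.closure
  refine ⟨Z, Submodule.isClosed_topologicalClosure _, hsep.separableSpace,
    fun n ω => ⟨u n ω, hmem n ω⟩, fun n => ?_, fun n ω => rfl⟩
  exact (Embedding.comp_stronglyMeasurable_iff IsEmbedding.subtypeVal).1 (hu n)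

variable {X : Type*} [NormedAddCommGroup X] [NormedSpace ℝ X] {mΩ : MeasurableSpace Ω}
  {μ : Measure Ω}

theorem mem_lpSub_iff {p : ℝ≥0∞} {m' : MeasurableSpace Ω} {Y : Submodule ℝ X}
    (hY : IsClosed (Y : Set X)) (g : Lp X p μ) :
    g ∈ lpSub p μ m' Y ↔ AEStronglyMeasurable[m'] g μ ∧ ∀ᵐ ω ∂μ, g ω ∈ Y := by
  constructor
  · rintro ⟨u, hu, hgu⟩
    refine ⟨⟨fun ω => u ω, continuous_subtype_val.comp_stronglyMeasurable hu, hgu⟩, ?_⟩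
    filter_upwards [hgu] with ω hω
    rw [hω]
    exact (u ω).2
  · rintro ⟨⟨w, hw, hgw⟩, hgY⟩
    -- The `Σ'`-measurable representative is reset to zero on the null set where it leaves `Y`;
    -- closedness of `Y` makes that set `Σ'`-measurable.
    have hs : MeasurableSet[m'] {ω | w ω ∈ Y} := by
      borelize X
      exact hw.measurable hY.measurableSet
    have hmem : ∀ ω, {ω | w ω ∈ Y}.indicator w ω ∈ Y := by
      intro ω
      by_cases hω : ω ∈ {ω | w ω ∈ Y}
      · rw [Set.indicator_of_mem hω]; exact hω
      · rw [Set.indicator_of_notMem hω]; exact Y.zero_mem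
    refine ⟨fun ω => ⟨_, hmem ω⟩, (Embedding.comp_stronglyMeasurable_iff IsEmbedding.subtypeVal).1
      (hw.indicator hs), ?_⟩
    filter_upwards [hgw, hgY] with ω h1 h2
    have : ω ∈ {ω | w ω ∈ Y} := by
      rw [Set.mem_ofPred_eq, ← h1]; exact h2
    rw [h1]
    exact (Set.indicator_of_mem this w).symm

/-- Taking values in `Y` almost everywhere means lying in the kernel of the continuous operator
induced by the quotient map `X → X ⧸ Y`. -/
theorem isClosed_lpSub_one [CompleteSpace X] {m' : MeasurableSpace Ω} (hm : m' ≤ mΩ)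
    {Y : Submodule ℝ X} (hY : IsClosed (Y : Set X)) :
    IsClosed (lpSub 1 μ m' Y : Set (Lp X 1 μ)) := by
  have h1 : ∀ g : Lp X 1 μ, (∀ᵐ ω ∂μ, g ω ∈ Y) ↔ Y.mkQL.compLpL 1 μ g = 0 := by
    intro g
    rw [Lp.ext_iff]
    constructor
    · intro h
      filter_upwards [h, Y.mkQL.coeFn_compLpL g, Lp.coeFn_zero (X ⧸ Y) 1 μ] with ω h2 h3 h4
      rw [h3, h4]
      exact (Submodule.Quotient.mk_eq_zero Y).2 h2
    · intro h
      filter_upwards [h, Y.mkQL.coeFn_compLpL g, Lp.coeFn_zero (X ⧸ Y) 1 μ] with ω h2 h3 h4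
      rw [h3, h4] at h2
      exact (Submodule.Quotient.mk_eq_zero Y).1 h2
  have h2 : (lpSub 1 μ m' Y : Set (Lp X 1 μ)) =
      {g : Lp X 1 μ | AEStronglyMeasurable[m'] g μ} ∩
        {g : Lp X 1 μ | Y.mkQL.compLpL 1 μ g = 0} := by
    ext g
    rw [SetLike.mem_coe, mem_lpSub_iff hY, h1]
    rfl
  rw [h2]
  exact (isClosed_aestronglyMeasurable hm).inter (isClosed_eq (by fun_prop) continuous_const)

end Subspaces

/-! ### The effect of truncation on tails and distances. -/

section Truncation

variable {Ω : Type*} {mΩ : MeasurableSpace Ω} {μ : Measure Ω}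
  {Z : Type*} [NormedAddCommGroup Z]

theorem setIntegral_norm_indicator_compl {w : Ω → Z} (hw : StronglyMeasurable w)
    (hi : Integrable w μ) {j k : ℝ} (hjk : j ≤ k) :
    ∫ ω in {ω | j < ‖{ω | k < ‖w ω‖}ᶜ.indicator w ω‖}, ‖{ω | k < ‖w ω‖}ᶜ.indicator w ω‖ ∂μ =
      (∫ ω in {ω | j < ‖w ω‖}, ‖w ω‖ ∂μ) - ∫ ω in {ω | k < ‖w ω‖}, ‖w ω‖ ∂μ := by
  have hms : ∀ c : ℝ, MeasurableSet {ω | c < ‖w ω‖} := fun c =>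
    measurableSet_lt measurable_const hw.norm.measurable
  have hms' : MeasurableSet {ω | j < ‖{ω | k < ‖w ω‖}ᶜ.indicator w ω‖} :=
    measurableSet_lt measurable_const (hw.indicator (hms k).compl).norm.measurable
  rw [← integral_indicator hms', ← integral_indicator (hms j), ← integral_indicator (hms k),
    ← integral_sub (hi.norm.indicator (hms j)) (hi.norm.indicator (hms k))]
  congr 1 with ω
  by_cases h1 : k < ‖w ω‖
  · have h2 : j < ‖w ω‖ := hjk.trans_lt h1
    simp [Set.indicator, h1, h2]
  · by_cases h2 : j < ‖w ω‖ <;> simp [Set.indicator, h1, h2, not_lt.1 h1]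

/-- Off `A` nothing changes; on `A` the pointwise inequality is `‖a‖ + ‖w‖ ≤ ‖w - a‖ + 2‖a‖`.
Truncation thus does not increase the distance to `a` once `w` has at least twice the mass of `a` on
`A`. -/
theorem norm_embedL1_indicator_sub_add_le [NormedSpace ℝ Z] {X : Type*} [NormedAddCommGroup X]
    [NormedSpace ℝ X] (J : Z →ₗᵢ[ℝ] X) {w : Ω → Z} (hw : Integrable w μ) {A : Set Ω}
    (hA : MeasurableSet A) (a : Lp X 1 μ) :
    ‖embedL1 J (hw.indicator hA.compl) - a‖ + ∫ ω in A, ‖w ω‖ ∂μ ≤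
      ‖embedL1 J hw - a‖ + 2 * ∫ ω in A, ‖a ω‖ ∂μ := by
  have ha : Integrable a μ := L1.integrable_coeFn a
  have hnorm : ∀ {v : Ω → Z} (hv : Integrable v μ),
      ‖embedL1 J hv - a‖ = ∫ ω, ‖J (v ω) - a ω‖ ∂μ := by
    intro v hv
    rw [L1.norm_eq_integral_norm]
    refine integral_congr_ae ?_
    filter_upwards [Lp.coeFn_sub (embedL1 J hv) a, coeFn_embedL1 J hv] with ω h1 h2
    rw [h1, Pi.sub_apply, h2]
  have hsub : ∀ {v : Ω → Z}, Integrable v μ → Integrable (fun ω => ‖J (v ω) - a ω‖) μ :=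
    fun hv => ((integrable_linearIsometry_comp J hv).sub ha).norm
  rw [hnorm, hnorm, ← integral_indicator hA, ← integral_indicator hA, ← integral_const_mul,
    ← integral_add (hsub (hw.indicator hA.compl)) (hw.norm.indicator hA),
    ← integral_add (hsub hw) ((ha.norm.indicator hA).const_mul 2)]
  refine integral_mono ((hsub (hw.indicator hA.compl)).add (hw.norm.indicator hA))
    ((hsub hw).add ((ha.norm.indicator hA).const_mul 2)) fun ω => ?_
  by_cases hω : ω ∈ A
  · simp only [Set.indicator, Set.mem_compl_iff, hω, not_true_eq_false, if_false, if_true,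
      map_zero, zero_sub, norm_neg]
    have := norm_le_norm_add_norm_sub' (J (w ω)) (a ω)
    rw [J.norm_map] at this
    linarith
  · simp [Set.indicator, hω]

end Truncation

/-! ### Existence of centers in `L_1(Σ', Y)` and `L_∞(Σ, Y)`. -/

section Existence

variable {X : Type*} [NormedAddCommGroup X] [NormedSpace ℝ X]
  {Ω : Type*} {mΩ : MeasurableSpace Ω} {μ : Measure Ω}

/-- A bounded sequence in `L_1(μ, Z)` can be replaced by a uniformly integrable sequence that, along
a subsequence, is not farther from the points of a given weakly compact set. -/
theorem exists_uniformly_integrable_seq [IsFiniteMeasure μ] {Z : Type*} [NormedAddCommGroup Z]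
    [NormedSpace ℝ Z] (J : Z →ₗᵢ[ℝ] X) {F : Set (Lp X 1 μ)} (hF : IsWeaklyCompact F)
    {m' : MeasurableSpace Ω} (hm : m' ≤ mΩ) {w : ℕ → Ω → Z}
    (hw : ∀ n, StronglyMeasurable[m'] (w n)) (hi : ∀ n, Integrable (w n) μ) {M : ℝ}
    (hM : ∀ n, ‖embedL1 J (hi n)‖ ≤ M) :
    ∃ (σ : ℕ → ℕ) (g : ℕ → Ω → Z) (hg : ∀ k, Integrable (g k) μ), (∀ k, k ≤ σ k) ∧
      (∀ k, StronglyMeasurable[m'] (g k)) ∧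
      (∀ ε > 0, ∃ c : ℝ, ∀ᶠ k in atTop, ∫ ω in {ω | c < ‖g k ω‖}, ‖g k ω‖ ∂μ ≤ ε) ∧
      ∀ᶠ k in atTop, ∀ a ∈ F, ‖embedL1 J (hg k) - a‖ ≤ ‖embedL1 J (hi (σ k)) - a‖ := by
  let A : ℕ → ℝ → Set Ω := fun n c => {ω | c < ‖w n ω‖}
  have hAm' : ∀ n c, MeasurableSet[m'] (A n c) := fun n c =>
    stronglyMeasurable_const.measurableSet_lt (hw n).norm
  have hAm : ∀ n c, MeasurableSet[mΩ] (A n c) := fun n c => hm _ (hAm' n c)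
  let I : ℕ → ℕ → ℝ := fun n j => ∫ ω in A n j, ‖w n ω‖ ∂μ
  have hI0 : ∀ n j, 0 ≤ I n j := fun n j => integral_nonneg fun _ => norm_nonneg _
  have hwM : ∀ n, ∫ ω, ‖w n ω‖ ∂μ ≤ M := fun n => by rw [← norm_embedL1 J (hi n)]; exact hM n
  have hanti : ∀ n, Antitone (I n) := fun n i j hij =>
    setIntegral_mono_set (hi n).norm.integrableOn (ae_of_all _ fun _ => norm_nonneg _)
      (ae_of_all _ fun ω hω => (Nat.cast_le.2 hij).trans_lt hω)
  have hIM : ∀ n j, I n j ≤ M := fun n j =>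
    (setIntegral_le_integral (hi n).norm (ae_of_all _ fun _ => norm_nonneg _)).trans (hwM n)
  obtain ⟨η, σ, hη, hσ, hdiag, htail⟩ := exists_subseq_tendsto_diagonal hI0 hanti hIM
  -- If no mass escapes, the subsequence is already uniformly integrable. Truncating would be
  -- harmful here: there would be no mass to offset the term `2 ∫_A ‖a‖`.
  rcases hη.eq_or_lt with rfl | hηp
  · refine ⟨σ, fun k => w (σ k), fun k => hi _, hσ, fun k => hw _, fun ε hε => ?_,
      Eventually.of_forall fun k a _ => le_rfl⟩
    obtain ⟨j, hj⟩ := htail (ε / 2) (half_pos hε)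
    refine ⟨j, ?_⟩
    filter_upwards [hj, hdiag.eventually_lt_const (half_pos hε)] with k h1 h2
    change I (σ k) j ≤ ε
    linarith
  · refine ⟨σ, fun k => (A (σ k) k)ᶜ.indicator (w (σ k)),
      fun k => (hi _).indicator (hAm _ _).compl, hσ,
      fun k => (hw _).indicator (hAm' _ _).compl, fun ε hε => ?_, ?_⟩
    · obtain ⟨j, hj⟩ := htail ε hε
      refine ⟨j, ?_⟩
      filter_upwards [hj, eventually_ge_atTop j] with k h1 h2
      refine (setIntegral_norm_indicator_compl ((hw (σ k)).mono hm) (hi _)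
        (Nat.cast_le.2 h2)).trans_le h1
    -- The removed mass eventually exceeds `η / 2`, while each `a` in `F` has mass at most `η / 4`
    -- on the removed set, whose measure is at most `M / k` by Markov's inequality.
    · obtain ⟨t, ht, hFt⟩ := hF.exists_pos_forall_setIntegral_norm_le
        (show 0 < η / 4 by positivity)
      have hlim : Tendsto (fun k : ℕ => M / (k : ℝ)) atTop (𝓝 0) :=
        tendsto_const_div_atTop_nhds_zero_nat M
      filter_upwards [hdiag.eventually_const_lt (half_lt_self hηp), hlim.eventually_lt_const ht,
        eventually_gt_atTop 0] with k h1 h2 h3 a ha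
      have hk : (0 : ℝ) < k := Nat.cast_pos.2 h3
      have hμ : μ.real (A (σ k) k) ≤ t := by
        refine le_trans ?_ h2.le
        rw [le_div_iff₀ hk, mul_comm]
        refine le_trans ?_ ((mul_meas_ge_le_integral_of_nonneg
          (ae_of_all _ fun ω => norm_nonneg (w (σ k) ω)) (hi (σ k)).norm k).trans (hwM _))
        exact mul_le_mul_of_nonneg_left (measureReal_mono fun ω (hω : (k : ℝ) < _) => hω.le) hk.le
      have h4 := hFt a ha _ (hAm _ _) hμ
      have h5 := norm_embedL1_indicator_sub_add_le J (hi (σ k)) (hAm (σ k) k) a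
      change η / 2 < ∫ ω in A (σ k) k, ‖w (σ k) ω‖ ∂μ at h1
      linarith

theorem cent_lpSub_one_nonempty [CompleteSpace X] {Y : Submodule ℝ X}
    (hYc : IsClosed (Y : Set X)) (hY : IsReflexive Y) [IsFiniteMeasure μ]
    {F : Set (Lp X 1 μ)} (hne : F.Nonempty) (hF : IsWeaklyCompact F)
    {m' : MeasurableSpace Ω} (hm : m' ≤ mΩ) {f : EllInfNonneg F → ℝ≥0} (hmono : Monotone f)
    (hcoer : Coercive f)
    (hlsc : LowerSemicontinuous fun x : WeakSpace ℝ (Lp X 1 μ) =>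
      r hF.isBounded f ((toWeakSpace ℝ (Lp X 1 μ)).symm x)) :
    (cent hF.isBounded f (lpSub 1 μ m' Y)).Nonempty := by
  have : Nonempty F := hne.to_subtype
  set V := lpSub 1 μ m' Y
  obtain ⟨x, hxV, hx⟩ := exists_minimizing_seq hF.isBounded f V
  obtain ⟨M, -, hM⟩ := hcoer.exists_norm_le (a := fun a : F => (a : Lp X 1 μ))
    (by rw [Subtype.range_coe]; exact hF.isBounded) (rad hF.isBounded f V + 1)
  have hxM : ∀ n, ‖x n‖ ≤ M := fun n => hM _ <| (hx n).trans <| by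
    gcongr
    exact div_le_self zero_le_one (by simp)
  choose u hu hxu using hxV
  obtain ⟨Z, hZc, hZsep, w, hw, hwu⟩ := exists_separable_factorization hu
  let J : Z →ₗᵢ[ℝ] X := Y.subtypeₗᵢ.comp Z.subtypeₗᵢ
  have hxJ : ∀ n, x n =ᵐ[μ] fun ω => J (w n ω) := fun n => by
    filter_upwards [hxu n] with ω hω
    rw [hω, ← hwu]
    rfl
  have hwi : ∀ n, Integrable (w n) μ := fun n => by
    refine (L1.integrable_coeFn (x n)).mono ((hw n).mono hm).aestronglyMeasurable ?_
    filter_upwards [hxJ n] with ω hω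
    rw [hω, J.norm_map]
  have hxe : ∀ n, embedL1 J (hwi n) = x n := fun n =>
    Lp.ext ((coeFn_embedL1 J (hwi n)).trans (hxJ n).symm)
  obtain ⟨σ, g, hg, hσ, hgm, hUI, hgF⟩ := exists_uniformly_integrable_seq J hF hm hw hwi
    fun n => by rw [hxe]; exact hxM n
  obtain ⟨z, hz⟩ := exists_forall_dual_tendsto_of_uniformly_integrable (hY.of_isClosed hZc) J
    (hyperfilter ℕ) (fun k => (hgm k).mono hm) hg fun ε hε => by
      obtain ⟨c, hc⟩ := hUI ε hε
      exact ⟨c, Nat.hyperfilter_le_atTop hc⟩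
  have hgV : ∀ k, embedL1 J (hg k) ∈ V := fun k =>
    ⟨fun ω => (g k ω : Y), continuous_subtype_val.comp_stronglyMeasurable (hgm k),
      coeFn_embedL1 J (hg k)⟩
  -- A norm closed subspace is weakly closed.
  have hzV : z ∈ V := mem_of_isClosed_of_dual_tendsto (isClosed_lpSub_one hm hYc) hgV hz
  refine ⟨z, mem_cent_of_eventually_lt hzV Nat.hyperfilter_le_atTop
    (x := fun k => embedL1 J (hg k)) ?_ fun c hc => ?_⟩
  · filter_upwards [Nat.hyperfilter_le_atTop hgF] with k hk
    -- Monotonicity of `f` turns the comparison of distances into minimality of the truncated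
    -- sequence; `k ≤ σ k` keeps the error below `1 / (k + 1)`.
    refine (rFam_le_rFam hmono fun a : F => ?_).trans ((hx (σ k)).trans ?_)
    · rw [← hxe]; exact hk a a.2
    · gcongr
      exact hσ k
  · exact (tendsto_toWeakSpace hz).eventually (hlsc (toWeakSpace ℝ _ z) c hc)

theorem integrable_dual_comp {Z : Type*} [NormedAddCommGroup Z] [NormedSpace ℝ Z] (J : Z →ₗᵢ[ℝ] X)
    {φ : Ω → StrongDual ℝ X} (hφ : Integrable φ μ) :
    Integrable (fun ω => (φ ω).comp J.toContinuousLinearMap) μ :=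
  ((ContinuousLinearMap.compL ℝ Z X ℝ).flip J.toContinuousLinearMap).integrable_comp hφ

theorem rDual_pairing [IsFiniteMeasure μ] {F : Set (Lp X ∞ μ)} (hF : Bornology.IsBounded F)
    (f : EllInfNonneg F → ℝ≥0) (x : Lp X ∞ μ) :
    rDual μ hF f (pairing (NormedSpace.inclusionInDoubleDual ℝ X) μ x) = r hF f x := by
  refine rFam_congr f fun a => ?_
  rw [← map_sub, norm_pairing_inclusionInDoubleDual]

theorem cent_lpSub_top_nonempty {Y : Submodule ℝ X} (hY : IsReflexive Y) [IsFiniteMeasure μ]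
    {F : Set (Lp X ∞ μ)} (hne : F.Nonempty) (hF : Bornology.IsBounded F)
    {f : EllInfNonneg F → ℝ≥0} (hcoer : Coercive f)
    (hlsc : LowerSemicontinuous fun x : WeakDual ℝ (Lp (StrongDual ℝ X) 1 μ) =>
      rDual μ hF f (WeakDual.toStrongDual x)) :
    (cent hF f (lpSub ∞ μ mΩ Y)).Nonempty := by
  have : Nonempty F := hne.to_subtype
  set V := lpSub ∞ μ mΩ Y
  obtain ⟨x, hxV, hx⟩ := exists_minimizing_seq hF f V
  obtain ⟨M, hM0, hM⟩ := hcoer.exists_norm_le (a := fun a : F => (a : Lp X ∞ μ))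
    (by rwa [Subtype.range_coe]) (rad hF f V + 1)
  have hxM : ∀ n, ‖x n‖ ≤ M := fun n => hM _ <| (hx n).trans <| by
    gcongr
    exact div_le_self zero_le_one (by simp)
  choose u hu hxu using hxV
  obtain ⟨Z, hZc, hZsep, w, hw, hwu⟩ := exists_separable_factorization hu
  let J : Z →ₗᵢ[ℝ] X := Y.subtypeₗᵢ.comp Z.subtypeₗᵢ
  have hxJ : ∀ n, x n =ᵐ[μ] fun ω => J (w n ω) := fun n => by
    filter_upwards [hxu n] with ω hω
    rw [hω, ← hwu]
    rfl
  -- Resetting `w n` on a null set turns the almost everywhere bound by `M` into one at every point.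
  let w' : ℕ → Ω → Z := fun n => {ω | ‖w n ω‖ ≤ M}.indicator (w n)
  have hw' : ∀ n, StronglyMeasurable (w' n) := fun n =>
    (hw n).indicator (measurableSet_le (hw n).norm.measurable measurable_const)
  have hw'b : ∀ n ω, ‖w' n ω‖ ≤ M := by
    intro n ω
    by_cases h : ω ∈ {ω | ‖w n ω‖ ≤ M}
    · simp only [w', Set.indicator_of_mem h]; exact h
    · simp only [w', Set.indicator_of_notMem h, norm_zero]; exact hM0
  have hxw' : ∀ n, x n =ᵐ[μ] fun ω => J (w' n ω) := fun n => by
    filter_upwards [hxJ n, ae_norm_le_norm_of_top (x n)] with ω h1 h2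
    have h3 : ω ∈ {ω | ‖w n ω‖ ≤ M} := by
      rw [h1, J.norm_map] at h2
      exact h2.trans (hxM n)
    simp only [w', Set.indicator_of_mem h3, h1]
  obtain ⟨v, hv, hvb, hlim⟩ := exists_ultralimit_of_bounded (μ := μ) (hY.of_isClosed hZc)
    (hyperfilter ℕ) hw' hM0 hw'b
  have hvL : MemLp (fun ω => J (v ω)) ∞ μ :=
    memLp_top_of_bound (J.continuous.comp_stronglyMeasurable hv).aestronglyMeasurable M
      (ae_of_all _ fun ω => (J.norm_map _).trans_le (hvb ω))
  let z : Lp X ∞ μ := hvL.toLp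
  have hzV : z ∈ V :=
    ⟨fun ω => (v ω : Y), continuous_subtype_val.comp_stronglyMeasurable hv, hvL.coeFn_toLp⟩
  let P := pairing (NormedSpace.inclusionInDoubleDual ℝ X) μ
  have hpair : ∀ (y : Lp X ∞ μ) (s : Ω → Z), (y =ᵐ[μ] fun ω => J (s ω)) →
      ∀ φ : Lp (StrongDual ℝ X) 1 μ,
        P y φ = ∫ ω, ((φ ω).comp J.toContinuousLinearMap) (s ω) ∂μ := by
    intro y s hys φ
    rw [pairing_apply]
    refine integral_congr_ae ?_
    filter_upwards [hys] with ω hω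
    rw [hω]
    rfl
  -- Restricting the values of `φ` to `Z` along `J` gives integrable `Z*`-valued test functions,
  -- against which `v` is the limit.
  have htend : Tendsto (fun n => (StrongDual.toWeakDual (P (x n)))) (hyperfilter ℕ)
      (𝓝 (StrongDual.toWeakDual (P z))) := by
    refine tendsto_iff_forall_eval_tendsto_topDualPairing.2 fun φ => ?_
    change Tendsto (fun n => P (x n) φ) (hyperfilter ℕ) (𝓝 (P z φ))
    simp only [hpair _ _ (hxw' _), hpair z v hvL.coeFn_toLp]
    exact hlim _ (integrable_dual_comp J (L1.integrable_coeFn φ))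
  refine ⟨z, mem_cent_of_eventually_lt hzV Nat.hyperfilter_le_atTop
    (Eventually.of_forall hx) fun c hc => ?_⟩
  have h1 := htend.eventually (hlsc (StrongDual.toWeakDual (P z)) c (by
    change c < rDual μ hF f (P z)
    rwa [rDual_pairing]))
  refine h1.mono fun n hn => ?_
  rw [← rDual_pairing]
  exact hn

end Existence

end FCenter

end

theorem theorem3p11 {X : Type*} [NormedAddCommGroup X] [NormedSpace ℝ X] [CompleteSpace X]
    (Y : Submodule ℝ X) (hYc : IsClosed (Y : Set X)) (hY : FCenter.IsReflexive Y)
    {Ω : Type*} {mΩ : MeasurableSpace Ω} (μ : Measure Ω) [IsFiniteMeasure μ] :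
    (∀ (F : Set (Lp X 1 μ)) (_ : F.Nonempty) (hF : FCenter.IsWeaklyCompact F)
        (m' : MeasurableSpace Ω) (_ : m' ≤ mΩ) (f : FCenter.EllInfNonneg F → ℝ≥0),
        Monotone f → FCenter.Coercive f →
        LowerSemicontinuous (fun x : WeakSpace ℝ (Lp X 1 μ) =>
          FCenter.r hF.isBounded f ((toWeakSpace ℝ (Lp X 1 μ)).symm x)) →
        (FCenter.cent hF.isBounded f (FCenter.lpSub 1 μ m' Y)).Nonempty) ∧
    (∀ (F : Set (Lp X ∞ μ)) (_ : F.Nonempty) (hF : Bornology.IsBounded F)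
        (f : FCenter.EllInfNonneg F → ℝ≥0),
        Monotone f → FCenter.Coercive f →
        LowerSemicontinuous (fun x : WeakDual ℝ (Lp (StrongDual ℝ X) 1 μ) =>
          FCenter.rDual μ hF f (WeakDual.toStrongDual x)) →
        (FCenter.cent hF f (FCenter.lpSub ∞ μ mΩ Y)).Nonempty) :=
  ⟨fun _ hne hF _ hm _ hmono hcoer hlsc =>
    FCenter.cent_lpSub_one_nonempty hYc hY hne hF hm hmono hcoer hlsc,
  fun _ hne hF _ _ hcoer hlsc => FCenter.cent_lpSub_top_nonempty hY hne hF hcoer hlsc⟩
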